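/- Let $d\in\{1,2,3\}$ and $\kappa\in\{2,4,6\}$. On $\ell^2(\mathbb Z^d)$ let $(S_ju)(n)=u(n_1,\dots,n_j-1,\dots,n_d)$, $\Delta_j=\tfrac12(S_j+S_j^{*})$, $(N_ju)(n)=n_ju(n)$, let $D=\Delta_1\cdots\Delta_d$ be the Molchanov–Vainberg Laplacian, and let $A_\kappa$ be the closure of $$\sum_{j=1}^d\frac1{4\mathrm i}\Big[(S_j^{\kappa}-S_j^{-\kappa})N_j+N_j(S_j^{\kappa}-S_j^{-\kappa})\Big]$$ defined on the finitely supported sequences. Let $\mu_{A_\kappa}(D)$ be the set of all $E\in\sigma(D)$ for which there are an open interval $I\ni E$, a number $\gamma>0$ and a sign $\mathbb A\in\{A_\kappa,-A_\kappa\}$ such that the strict Mourre estimate $$E_I(D)\,[D,\mathrm i\mathbb A]_\circ\,E_I(D)\ \ge\ \gamma\,E_I(D)$$ holds, where $E_I(D)$ is the spectral projection of $D$ onto $I$ and $[D,\mathrm i\mathbb A]_\circ$ is the bounded operator that extends the commutator form on $\mathrm{Dom}(\mathbb A)\times\mathrm{Dom}(\mathbb A)$. **Theorem.** The set $\mu_{A_\kappa}(D)$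 is symmetric about $0$, and the following holds. (a) The following open sets are contained in $\mu_{A_\kappa}(D)\cap[0,1]$: - $\kappa=2$: $(0,1)$ for $d=1,2,3$; - $\kappa=4$: $(0,1)\setminus\{\tfrac1{\sqrt2}\}$ for $d=1$; $(0,\tfrac12)\cup(\tfrac1{\sqrt2},1)$ for $d=2$; $\big(0,\tfrac{\sqrt{3-\sqrt3}}4\big)\cup(\tfrac1{\sqrt2},1)$ for $d=3$; - $\kappa=6$: $(0,1)\setminus\{\tfrac12,\tfrac{\sqrt3}2\}$ for $d=1$; $(0,0.21)\cup(0.53,0.71)\cup(\tfrac{\sqrt3}2,1)$ for $d=2$; $(0,0.08)\cup(0.57,0.58)\cup(\tfrac{\sqrt3}2,1)$ for $d=3$. (b) The following closed sets are contained in $[0,1]\setminus\mu_{A_\kappa}(D)$: - $\kappa=2$: $\{0,1\}$ for $d=1,2,3$; - $\kappa=4$: $\{0,\tfrac1{\sqrt2},1\}$ for $d=1$; $[\tfrac12,\tfrac1{\sqrt2}]\cup\{0,1\}$ for $d=2$; $[\tfrac1{2\sqrt2},\tfrac1{\sqrt2}]\cup\{0,1\}$ for $d=3$; - $\kappa=6$: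 $\{0,\tfrac12,\tfrac{\sqrt3}2,1\}$ for $d=1$; $[\tfrac14,\tfrac12]\cup[\tfrac34,\tfrac{\sqrt3}2]\cup\{0,1\}$ for $d=2$; $[\tfrac18,\tfrac12]\cup[\tfrac{3\sqrt3}8,\tfrac{\sqrt3}2]\cup\{0,1\}$ for $d=3$. (c) In particular $\mu_{A_2}(D)=\pm(0,1)$ for $d=1,2,3$; for $d=1$, $\mu_{A_4}(D)=\pm\big((0,1)\setminus\{\tfrac1{\sqrt2}\}\big)$ and $\mu_{A_6}(D)=\pm\big((0,1)\setminus\{\tfrac12,\tfrac{\sqrt3}2\}\big)$; and $\mu_{A_4}(D)=\pm(0,\tfrac12)\cup\pm(\tfrac1{\sqrt2},1)$ for $d=2$. Here $\pm X=X\cup(-X)$. -/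

import Mathlib

open scoped ENNReal InnerProductSpace

noncomputable section

namespace MolchanovVainberg

/-! ## Strict Mourre estimates for a bounded operator -/

section Abstract

variable {H : Type*} [NormedAddCommGroup H] [InnerProductSpace ℂ H] [CompleteSpace H]

/-- The range of the spectral projection `E_U(T)` of a bounded self-adjoint operator `T` onto an
open set `U ⊆ ℝ`: the closed linear span of the ranges of the operators `f(T)` (continuous
functional calculus), where `f : ℝ → ℝ` is continuous and vanishes outside `U`.  (Since `U` is open
its indicator function is the increasing pointwise limit of such functions `f`, so this closed
subspace is the range of `1_U(T)`.) -/
def spectralSubspace (T : H →L[ℂ] H) (U : Set ℝ) : Submodule ℂ H :=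
  (⨆ f : {f : C(ℝ, ℝ) // ∀ x, x ∉ U → f x = 0},
    LinearMap.range (cfc (f : ℝ → ℝ) T : H →L[ℂ] H).toLinearMap).topologicalClosure

instance (T : H →L[ℂ] H) (U : Set ℝ) : CompleteSpace (spectralSubspace T U) :=
  (Submodule.isClosed_topologicalClosure _).completeSpace_coe

/-- The spectral projection `E_U(T)` of a bounded self-adjoint operator `T` onto an open set
`U ⊆ ℝ`, as a bounded operator: the orthogonal projection onto `spectralSubspace T U`. -/
def spectralProjection (T : H →L[ℂ] H) (U : Set ℝ) : H →L[ℂ] H :=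
  (spectralSubspace T U).starProjection

/-- `C` is the bounded operator `[T, iA]_∘`, i.e. the bounded extension of the form
`⟨ψ, [T, iA] φ⟩ = i (⟨T ψ, A φ⟩ - ⟨A ψ, T φ⟩)` on `Dom A × Dom A`.  Such a `C` is unique when `A` is
densely defined; its existence means that `T` is of class `C¹(A)`. -/
def IsBoundedCommutator (T : H →L[ℂ] H) (A : H →ₗ.[ℂ] H) (C : H →L[ℂ] H) : Prop :=
  ∀ ψ φ : A.domain,
    ⟪(ψ : H), C φ⟫_ℂ = Complex.I * (⟪T ψ, A φ⟫_ℂ - ⟪A ψ, T φ⟫_ℂ)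

/-- The strict Mourre estimate `E_I(T) [T, iA]_∘ E_I(T) ≥ γ E_I(T)`, in the sense of quadratic
forms; it includes the statement that the bounded operator `[T, iA]_∘` exists. -/
def StrictMourreEstimate (T : H →L[ℂ] H) (A : H →ₗ.[ℂ] H) (I : Set ℝ) (γ : ℝ) : Prop :=
  ∃ C : H →L[ℂ] H, IsBoundedCommutator T A C ∧
    (γ : ℂ) • spectralProjection T I ≤
      spectralProjection T I * C * spectralProjection T I

/-- `μ⁺_A(T)`: the energies in the spectrum of `T` that have an open interval around them on which
a strict Mourre estimate for `T` with respect to `A` holds. -/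
def mourreSetPlus (T : H →L[ℂ] H) (A : H →ₗ.[ℂ] H) : Set ℝ :=
  {E | E ∈ spectrum ℝ T ∧
    ∃ a b γ : ℝ, E ∈ Set.Ioo a b ∧ 0 < γ ∧ StrictMourreEstimate T A (Set.Ioo a b) γ}

/-- `μ_A(T) = μ⁺_A(T) ∪ μ⁻_A(T)`, where `μ⁻_A(T) = μ⁺_{-A}(T)`. -/
def mourreSet (T : H →L[ℂ] H) (A : H →ₗ.[ℂ] H) : Set ℝ :=
  mourreSetPlus T A ∪ mourreSetPlus T (-A)

end Abstract

/-! ## Shifts and position operators on sequences indexed by `ℤ^d` -/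

/-- The Hilbert space `ℓ²(ℤ^d)`. -/
abbrev L2Z (d : ℕ) : Type := lp (fun _ : Fin d → ℤ => ℂ) 2

/-- The shift `S_j^k` on arbitrary sequences: `(S_j^k u)(n) = u(n₁, …, n_j - k, …, n_d)`. -/
def seqShift {d : ℕ} (j : Fin d) (k : ℤ) : ((Fin d → ℤ) → ℂ) →ₗ[ℂ] ((Fin d → ℤ) → ℂ) where
  toFun u n := u (n - Pi.single j k)
  map_add' _ _ := rfl
  map_smul' _ _ := rfl

/-- The position operator `N_j` on arbitrary sequences: `(N_j u)(n) = n_j u(n)`. -/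
def seqPos {d : ℕ} (j : Fin d) : ((Fin d → ℤ) → ℂ) →ₗ[ℂ] ((Fin d → ℤ) → ℂ) where
  toFun u n := (n j : ℂ) * u n
  map_add' u v := by ext n; simp [mul_add]
  map_smul' c u := by ext n; simp [mul_left_comm]

/-- The formal expression
`A_κ = ∑_j (1/4i) [(S_j^κ_j - S_j^(-κ_j)) N_j + N_j (S_j^κ_j - S_j^(-κ_j))]` on sequences. -/
def seqConj {d : ℕ} (κ : Fin d → ℕ) : ((Fin d → ℤ) → ℂ) →ₗ[ℂ] ((Fin d → ℤ) → ℂ) :=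
  ∑ j, (1 / (4 * Complex.I)) •
    ((seqShift j (κ j) - seqShift j (-(κ j : ℤ))) ∘ₗ seqPos j +
      seqPos j ∘ₗ (seqShift j (κ j) - seqShift j (-(κ j : ℤ))))

/-- The finitely supported sequences. -/
def finSeq (d : ℕ) : Submodule ℂ ((Fin d → ℤ) → ℂ) where
  carrier := {u | u.support.Finite}
  add_mem' {u v} hu hv := (Set.Finite.union hu hv).subset (Function.support_add u v)
  zero_mem' := by simp [Function.support_zero]
  smul_mem' c u hu := Set.Finite.subset hu (Function.support_const_smul_subset c u)

lemma seqShift_mem_finSeq {d : ℕ} (j : Fin d) (k : ℤ) {u : (Fin d → ℤ) → ℂ}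
    (hu : u ∈ finSeq d) : seqShift j k u ∈ finSeq d := by
  have h : (Function.support u).Finite := hu
  exact h.preimage (f := fun n : Fin d → ℤ => n - Pi.single j k) sub_left_injective.injOn

lemma seqPos_mem_finSeq {d : ℕ} (j : Fin d) {u : (Fin d → ℤ) → ℂ}
    (hu : u ∈ finSeq d) : seqPos j u ∈ finSeq d :=
  Set.Finite.subset hu (Function.support_mul_subset_right _ _)

lemma seqConj_mem_finSeq {d : ℕ} (κ : Fin d → ℕ) {u : (Fin d → ℤ) → ℂ}
    (hu : u ∈ finSeq d) : seqConj κ u ∈ finSeq d := by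
  simp only [seqConj, LinearMap.sum_apply]
  refine (finSeq d).sum_mem fun j _ => ?_
  refine (finSeq d).smul_mem _ ((finSeq d).add_mem ((finSeq d).sub_mem ?_ ?_)
    (seqPos_mem_finSeq j ((finSeq d).sub_mem ?_ ?_)))
  · exact seqShift_mem_finSeq _ _ (seqPos_mem_finSeq j hu)
  · exact seqShift_mem_finSeq _ _ (seqPos_mem_finSeq j hu)
  · exact seqShift_mem_finSeq _ _ hu
  · exact seqShift_mem_finSeq _ _ hu

lemma memlp_of_mem_finSeq {d : ℕ} {u : (Fin d → ℤ) → ℂ} (hu : u ∈ finSeq d) : Memℓp u 2 :=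
  (memℓp_zero hu).of_exponent_ge zero_le

lemma memlp_seqShift {d : ℕ} (j : Fin d) (k : ℤ) {u : (Fin d → ℤ) → ℂ} (hu : Memℓp u 2) :
    Memℓp (seqShift j k u) 2 := by
  have h2 : 0 < (2 : ℝ≥0∞).toReal := by simp
  exact memℓp_gen (((Equiv.subRight (Pi.single j k : Fin d → ℤ)).summable_iff
    (f := fun n => ‖u n‖ ^ (2 : ℝ≥0∞).toReal)).2 (hu.summable h2))

/-! ## The operators on `ℓ²(ℤ^d)` -/

/-- The shift `S_j^k` as a bounded operator on `ℓ²(ℤ^d)`. -/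
def shift {d : ℕ} (j : Fin d) (k : ℤ) : L2Z d →L[ℂ] L2Z d :=
  LinearIsometry.toContinuousLinearMap
    { toFun := fun u => ⟨seqShift j k u, memlp_seqShift j k (lp.memℓp u)⟩
      map_add' := fun _ _ => rfl
      map_smul' := fun _ _ => rfl
      norm_map' := fun u => by
        have h2 : 0 < (2 : ℝ≥0∞).toReal := by simp
        rw [lp.norm_eq_tsum_rpow h2, lp.norm_eq_tsum_rpow h2]
        congr 1
        exact (Equiv.subRight (Pi.single j k : Fin d → ℤ)).tsum_eq
          (fun n => ‖u n‖ ^ (2 : ℝ≥0∞).toReal) }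

/-- `Δ_j = (S_j + S_j⁻¹) / 2`. -/
def lap {d : ℕ} (j : Fin d) : L2Z d →L[ℂ] L2Z d :=
  (1 / 2 : ℂ) • (shift j 1 + shift j (-1))

/-- The Molchanov–Vainberg Laplacian `D = Δ_1 Δ_2 ⋯ Δ_d` on `ℓ²(ℤ^d)`. -/
def mvLap (d : ℕ) : L2Z d →L[ℂ] L2Z d :=
  (List.ofFn fun j : Fin d => lap j).prod

/-- The operator `A_κ` on the domain of finitely supported sequences. -/
def conjCore {d : ℕ} (κ : Fin d → ℕ) : L2Z d →ₗ.[ℂ] L2Z d where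
  domain :=
    { carrier := {u | (u : (Fin d → ℤ) → ℂ) ∈ finSeq d}
      add_mem' := fun hu hv => (finSeq d).add_mem hu hv
      zero_mem' := (finSeq d).zero_mem
      smul_mem' := fun c _ hu => (finSeq d).smul_mem c hu }
  toFun :=
    { toFun := fun u => ⟨seqConj κ (u : L2Z d),
        memlp_of_mem_finSeq (seqConj_mem_finSeq κ u.2)⟩
      map_add' := fun _ _ => Subtype.ext ((seqConj κ).map_add _ _)
      map_smul' := fun c _ => Subtype.ext ((seqConj κ).map_smul c _) }

/-- The conjugate operator `A_κ` on `ℓ²(ℤ^d)`: the closure of `conjCore κ`. -/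
def conjOp {d : ℕ} (κ : Fin d → ℕ) : L2Z d →ₗ.[ℂ] L2Z d :=
  (conjCore κ).closure

/-- `μ_{A_κ}(D)` for the Molchanov–Vainberg Laplacian `D` on `ℓ²(ℤ^d)` and `κ_1 = ⋯ = κ_d = κ`. -/
def mu (d κ : ℕ) : Set ℝ :=
  mourreSet (mvLap d) (conjOp fun _ : Fin d => κ)

end MolchanovVainberg

end

/-! Under the Fourier transform `D` becomes multiplication on the torus by `f = ∏ cos a_j`, and `[D,
iA_κ]` becomes multiplication by the continuous function `g = ∑_j (∏_{i ≠ j} cos a_i) sin (κ a_j)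
sin a_j`. For continuous symbols on a compact space, a strict Mourre estimate near `E` is equivalent
to `g > 0` on the level set `f = E`: compactness spreads positivity to a neighbouring energy shell,
and test vectors localised in energy give the converse (`mem_mourreSetPlus_iff`).

For κ = 2, 4, 6 one has `sin (κ a) sin a = cos a · h (cos² a)` with a polynomial `h`, so `g = f · ∑
h (t_j)` with `t_j = cos² a_j`. Hence (`mem_mu_iff`) a nonzero `E ∈ [-1, 1]` lies in the Mourre set
iff `∑ h (t_j)` keeps one strict sign on the surface `∏ t_j = E²` in the unit cube. Only `E²`
enters, which gives the symmetry, and `E = 0` fails because `g` carries the factor `E`.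

Membership is then a family of polynomial inequalities. On the top band every `t_j ≥ E²`, and `h` is
positive on `[E², 1)` (`mem_mu_of_forall_pos`). The other bands with d ≥ 2 and κ = 4, 6 use
estimates in the sum and product of two coordinates; in three variables the product bound forces one
coordinate into a range where `h` is well controlled.

Exclusion is the intermediate value theorem (`notMem_mu_of_pow_eq`): the curve `(E²/s^(d-1), s, …,
s)` stays on the surface and joins its diagonal point to `(E², 1, …, 1)`. As `h 1 = 0`, the sum runs
from `d · h r`, where `r^d = E²`, to `h (E²)`, and it vanishes on the way if these do not have the
same strict sign. -/

open scoped ENNReal InnerProductSpace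

noncomputable section

namespace MolchanovVainberg

/-! ### Real symbols inside the complex function algebra -/

section ContinuousSymbols

variable {X : Type*} [TopologicalSpace X]

/-- A real continuous function, regarded as a complex one. -/
def toComplex (f : C(X, ℝ)) : C(X, ℂ) := ⟨fun x => (f x : ℂ), by fun_prop⟩

@[simp] lemma toComplex_apply (f : C(X, ℝ)) (x : X) : toComplex f x = (f x : ℂ) := rfl

lemma star_toComplex (f : C(X, ℝ)) : star (toComplex f) = toComplex f := by
  ext x; simp

lemma toComplex_mul (f g : C(X, ℝ)) : toComplex (f * g) = toComplex f * toComplex g := by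
  ext x; simp

lemma toComplex_sub (f g : C(X, ℝ)) : toComplex (f - g) = toComplex f - toComplex g := by
  ext x; simp

lemma toComplex_neg (f : C(X, ℝ)) : toComplex (-f) = -toComplex f := by
  ext x; simp

/-- Evaluation at each point is a star homomorphism to `ℂ`, so the functional calculus may be
computed pointwise. The calculus is the complex one, with `φ` precomposed by the real part, so that
the complex homomorphism `Φ` below can be pushed through it. -/
lemma cfc_toComplex [CompactSpace X] (φ : C(ℝ, ℝ)) (f : C(X, ℝ)) :
    cfc (fun z : ℂ => (φ z.re : ℂ)) (toComplex f) = toComplex (φ.comp f) := by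
  ext x
  have hf : IsSelfAdjoint (toComplex f) := star_toComplex f
  have hn : IsStarNormal (toComplex f) := hf.isStarNormal
  have h := StarAlgHomClass.map_cfc (R := ℂ) (S := ℂ) (ContinuousMap.evalStarAlgHom ℂ ℂ x)
    (fun z : ℂ => (φ z.re : ℂ)) (toComplex f) (by fun_prop)
    (continuous_eval_const x) hn (hf.map _).isStarNormal
  have h2 := cfc_algebraMap (A := ℂ) (f x : ℂ) (fun z : ℂ => (φ z.re : ℂ))
  exact h.trans h2

end ContinuousSymbols

/-! ### The Mourre estimate as positivity of a symbol on a level set -/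

section Criterion

variable {H : Type*} [NormedAddCommGroup H] [InnerProductSpace ℂ H] [CompleteSpace H]
variable {X : Type*} [TopologicalSpace X] [CompactSpace X]
variable (Φ : C(X, ℂ) →⋆ₐ[ℂ] (H →L[ℂ] H))

lemma cfc_symbol (φ : C(ℝ, ℝ)) (f : C(X, ℝ)) :
    cfc (φ : ℝ → ℝ) (Φ (toComplex f)) = Φ (toComplex (φ.comp f)) := by
  have hf : IsSelfAdjoint (toComplex f) := star_toComplex f
  have hΦ : Continuous Φ := AddMonoidHomClass.continuous_of_bound Φ 1 fun a => by
    rw [one_mul]; exact NonUnitalStarAlgHom.norm_apply_le Φ a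
  rw [← cfc_toComplex, cfc_real_eq_complex (a := Φ (toComplex f)) (φ : ℝ → ℝ) (hf.map _)]
  exact (StarAlgHomClass.map_cfc (R := ℂ) (S := ℂ) Φ (fun z : ℂ => (φ z.re : ℂ)) (toComplex f)
    (by fun_prop) hΦ hf.isStarNormal (hf.map _).isStarNormal).symm

omit [CompactSpace X] in
lemma adjoint_symbol (f : C(X, ℝ)) :
    ContinuousLinearMap.adjoint (Φ (toComplex f)) = Φ (toComplex f) := by
  rw [← ContinuousLinearMap.star_eq_adjoint, ← map_star, star_toComplex]

omit [CompactSpace X] in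
lemma inner_symbol_mul (f g : C(X, ℝ)) (u v : H) :
    ⟪u, Φ (toComplex (f * g)) v⟫_ℂ = ⟪Φ (toComplex f) u, Φ (toComplex g) v⟫_ℂ := by
  rw [toComplex_mul, map_mul, mul_apply_eq_comp, ← ContinuousLinearMap.adjoint_inner_left,
    adjoint_symbol]

omit [CompactSpace X] in
lemma inner_symbol_nonneg {f : C(X, ℝ)} (hf : ∀ x, 0 ≤ f x) (u : H) :
    0 ≤ (⟪u, Φ (toComplex f) u⟫_ℂ).re := by
  let s : C(X, ℝ) := ⟨fun x => √(f x), by fun_prop⟩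
  have hs : f = s * s := by
    ext x; simp [s, Real.mul_self_sqrt (hf x)]
  rw [hs, inner_symbol_mul]
  exact inner_self_nonneg (𝕜 := ℂ)

omit [CompactSpace X] in
-- With `m` the negative part of `f` and `q = m^(3/2)`, one has `m f m = -q²`. The form on the
-- vectors `Φ(m) u` is therefore `-‖Φ(q) u‖²`, which forces `Φ(q) = 0`, and then `q = 0` by
-- injectivity.
lemma nonneg_of_inner_symbol_nonneg (hΦ : Function.Injective Φ) {f : C(X, ℝ)}
    (hf : ∀ u, 0 ≤ (⟪u, Φ (toComplex f) u⟫_ℂ).re) (x : X) : 0 ≤ f x := by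
  let m : C(X, ℝ) := ⟨fun x => max (-f x) 0, by fun_prop⟩
  let r : C(X, ℝ) := ⟨fun x => √(max (-f x) 0), by fun_prop⟩
  have hm : ∀ x, 0 ≤ m x := fun x => le_max_right _ _
  let q : C(X, ℝ) := m * r
  have hq : m * f * m = -(q * q) := by
    ext x
    have h1 : r x * r x = m x := Real.mul_self_sqrt (hm x)
    have h2 : m x * f x = - (m x * m x) := by
      rcases le_total 0 (f x) with h | h
      · have : m x = 0 := max_eq_right (by linarith)
        simp [this]
      · have : m x = -f x := max_eq_left (by linarith)
        rw [this]; ring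
    simp only [ContinuousMap.mul_apply, ContinuousMap.neg_apply, q]
    calc m x * f x * m x = -(m x * m x) * m x := by rw [h2]
      _ = -(m x * (r x * r x) * m x) := by rw [h1]; ring
      _ = _ := by ring
  have h0 : Φ (toComplex q) = 0 := by
    ext1 u
    have h := hf (Φ (toComplex m) u)
    rw [← mul_apply_eq_comp, ← map_mul, ← toComplex_mul, ← inner_symbol_mul, ← mul_assoc, hq,
      toComplex_neg, map_neg, neg_apply, inner_neg_right, inner_symbol_mul, Complex.neg_re] at h
    have h2 : 0 ≤ (⟪Φ (toComplex q) u, Φ (toComplex q) u⟫_ℂ).re := inner_self_nonneg (𝕜 := ℂ)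
    have h3 : (⟪Φ (toComplex q) u, Φ (toComplex q) u⟫_ℂ).re = ‖Φ (toComplex q) u‖ ^ 2 :=
      inner_self_eq_norm_sq (𝕜 := ℂ) _
    have h4 : ‖Φ (toComplex q) u‖ ^ 2 = 0 := le_antisymm (by linarith) (sq_nonneg _)
    simpa using h4
  have h1 : toComplex q = 0 := hΦ (by rw [h0, map_zero])
  have h2 : q x = 0 := by
    have := congrArg (fun f : C(X, ℂ) => f x) h1
    simpa using this
  by_contra! hx
  have hmx : 0 < m x := lt_max_of_lt_left (by linarith)
  have : 0 < q x := mul_pos hmx (Real.sqrt_pos.2 hmx)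
  linarith

/-- A tent function at `E`, which vanishes at distance at least `δ` from `E`. -/
def tent (E δ : ℝ) : C(ℝ, ℝ) := ⟨fun y => max (δ - |y - E|) 0, by fun_prop⟩

lemma tent_self {E δ : ℝ} (hδ : 0 < δ) : 0 < tent E δ E := by simp [tent, hδ]

lemma tent_eq_zero {E δ y : ℝ} (h : δ ≤ |y - E|) : tent E δ y = 0 := by simp [tent, h]

/-- A plateau function, equal to `1` at distance at most `δ` of `E` and to `0` at distance at least
`2 * δ`. -/
def plateau (E δ : ℝ) : C(ℝ, ℝ) := ⟨fun y => max (min 1 (2 - |y - E| / δ)) 0, by fun_prop⟩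

lemma plateau_eq_one {E δ y : ℝ} (hδ : 0 < δ) (h : |y - E| ≤ δ) : plateau E δ y = 1 := by
  have : |y - E| / δ ≤ 1 := (div_le_one hδ).2 h
  simp only [plateau, ContinuousMap.coe_mk]
  rw [min_eq_left (by linarith), max_eq_left zero_le_one]

lemma plateau_eq_zero {E δ y : ℝ} (hδ : 0 < δ) (h : 2 * δ ≤ |y - E|) : plateau E δ y = 0 := by
  have : 2 ≤ |y - E| / δ := (le_div_iff₀ hδ).2 h
  exact max_eq_right ((min_le_right _ _).trans (by linarith))

lemma mem_spectrum_symbol (hΦ : Function.Injective Φ) (f : C(X, ℝ)) (E : ℝ) :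
    E ∈ spectrum ℝ (Φ (toComplex f)) ↔ ∃ x, f x = E := by
  constructor
  · intro hE
    by_contra! hx
    apply hE
    have hu : IsUnit (algebraMap ℝ C(X, ℂ) E - toComplex f) := by
      rw [ContinuousMap.isUnit_iff_forall_ne_zero]
      intro x h0
      have : ((E - f x : ℝ) : ℂ) = 0 := by
        rw [Complex.ofReal_sub]; exact h0
      exact hx x (by have := Complex.ofReal_eq_zero.1 this; linarith)
    have h := hu.map Φ
    have h2 : Φ (algebraMap ℝ C(X, ℂ) E) = algebraMap ℝ (H →L[ℂ] H) E := by
      have : algebraMap ℝ C(X, ℂ) E = (E : ℂ) • 1 := by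
        rw [Algebra.algebraMap_eq_smul_one]; ext; simp
      rw [this, map_smul, map_one, Algebra.algebraMap_eq_smul_one]
      ext; simp
    rwa [map_sub, h2] at h
  · rintro ⟨x, rfl⟩
    by_contra hE
    obtain ⟨δ, hδ, hball⟩ := Metric.isOpen_iff.1
      (spectrum.isClosed (𝕜 := ℝ) (Φ (toComplex f))).isOpen_compl (f x) hE
    -- A tent supported in the resolvent set acts as zero, whereas its symbol is positive at `x`.
    have h0 : cfc (tent (f x) δ : ℝ → ℝ) (Φ (toComplex f)) = 0 := by
      rw [cfc_congr (g := fun _ => 0), cfc_const_zero]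
      intro y hy
      apply tent_eq_zero
      by_contra! hlt
      exact hball (by rwa [Metric.mem_ball, Real.dist_eq]) hy
    rw [cfc_symbol] at h0
    have h1 : toComplex ((tent (f x) δ).comp f) = 0 := hΦ (by rw [h0, map_zero])
    have := congrArg (fun f : C(X, ℂ) => f x) h1
    simp only [toComplex_apply, ContinuousMap.comp_apply, ContinuousMap.zero_apply,
      Complex.ofReal_eq_zero] at this
    exact (tent_self hδ).ne' this

/-- If `f` vanishes off `U` then `χ f = f`, so the generators lie in the closed kernel of `χ(T) -
1`. -/
lemma apply_eq_self_of_mem_spectralSubspace {T : H →L[ℂ] H} {U : Set ℝ} {χ : C(ℝ, ℝ)}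
    (hχ : ∀ y ∈ U, χ y = 1) {u : H} (hu : u ∈ spectralSubspace T U) :
    cfc (χ : ℝ → ℝ) T u = u := by
  have hle : spectralSubspace T U ≤
      LinearMap.ker ((cfc (χ : ℝ → ℝ) T - 1 : H →L[ℂ] H).toLinearMap) := by
    refine Submodule.topologicalClosure_minimal _ (iSup_le ?_)
      (ContinuousLinearMap.isClosed_ker (cfc (χ : ℝ → ℝ) T - 1 : H →L[ℂ] H))
    rintro ⟨f, hf⟩ _ ⟨v, rfl⟩
    have h : cfc (χ : ℝ → ℝ) T * cfc (f : ℝ → ℝ) T = cfc (f : ℝ → ℝ) T := by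
      rw [← cfc_mul _ _ T χ.continuous.continuousOn f.continuous.continuousOn]
      congr 1
      ext y
      by_cases hy : y ∈ U
      · rw [hχ y hy, one_mul]
      · rw [hf y hy, mul_zero]
    have h2 := congrArg (fun S : H →L[ℂ] H => S v) h
    simp only [mul_apply_eq_comp] at h2
    simp [h2]
  have := hle hu
  simpa [sub_eq_zero] using this

lemma cfc_apply_mem_spectralSubspace (T : H →L[ℂ] H) {U : Set ℝ} {f : C(ℝ, ℝ)}
    (hf : ∀ y, y ∉ U → f y = 0) (u : H) : cfc (f : ℝ → ℝ) T u ∈ spectralSubspace T U := by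
  apply Submodule.le_topologicalClosure
  exact Submodule.mem_iSup_of_mem (⟨f, hf⟩ : {f : C(ℝ, ℝ) // ∀ x, x ∉ U → f x = 0}) ⟨u, rfl⟩

omit [CompleteSpace H] in
lemma inner_starProjection_conj {K : Submodule ℂ H} [K.HasOrthogonalProjection]
    (C : H →L[ℂ] H) (u : H) :
    ⟪u, (K.starProjection * C * K.starProjection) u⟫_ℂ =
      ⟪K.starProjection u, C (K.starProjection u)⟫_ℂ := by
  simp only [mul_apply_eq_comp]
  rw [Submodule.inner_starProjection_left_eq_right]

/-- A lower bound for a self-adjoint operator compressed by a projection, in terms of the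
quadratic form on the range of the projection. -/
lemma smul_starProjection_le_iff {K : Submodule ℂ H} [K.HasOrthogonalProjection]
    {C : H →L[ℂ] H} (hC : IsSelfAdjoint C) (γ : ℝ) :
    (γ : ℂ) • K.starProjection ≤ K.starProjection * C * K.starProjection ↔
      ∀ u ∈ K, γ * ‖u‖ ^ 2 ≤ (⟪u, C u⟫_ℂ).re := by
  have key : ∀ u : H, (⟪u, (K.starProjection * C * K.starProjection -
      (γ : ℂ) • K.starProjection) u⟫_ℂ).re =
      (⟪K.starProjection u, C (K.starProjection u)⟫_ℂ).re - γ * ‖K.starProjection u‖ ^ 2 := by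
    intro u
    have h2 : ⟪u, K.starProjection u⟫_ℂ = ((‖K.starProjection u‖ ^ 2 : ℝ) : ℂ) := by
      have h3 : K.starProjection (K.starProjection u) = K.starProjection u :=
        Submodule.starProjection_eq_self_iff.2 (K.starProjection_apply_mem u)
      rw [← h3, ← Submodule.inner_starProjection_left_eq_right, h3, inner_self_eq_norm_sq_to_K]
      simp
    rw [sub_apply, inner_sub_right, inner_starProjection_conj,
      smul_apply, inner_smul_right, h2, ← Complex.ofReal_mul, Complex.sub_re,
      Complex.ofReal_re]
  rw [ContinuousLinearMap.le_def]
  constructor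
  · intro h u hu
    have h1 : 0 ≤ (⟪u, (K.starProjection * C * K.starProjection -
      (γ : ℂ) • K.starProjection) u⟫_ℂ).re := h.re_inner_nonneg_right u
    rw [key, Submodule.starProjection_eq_self_iff.2 hu] at h1
    linarith
  · intro h
    rw [ContinuousLinearMap.isPositive_iff']
    have hS : IsSelfAdjoint (K.starProjection * C * K.starProjection -
        (γ : ℂ) • K.starProjection) := by
      have hP : IsSelfAdjoint K.starProjection := isSelfAdjoint_starProjection K
      refine IsSelfAdjoint.sub ?_ (IsSelfAdjoint.smul (by simp [IsSelfAdjoint]) hP)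
      · have := hC.conjugate K.starProjection
        rwa [hP.star_eq] at this
    refine ⟨hS, fun u => ?_⟩
    · have h1 := h _ (K.starProjection_apply_mem u)
      have h2 := key u
      have h3 : ⟪(K.starProjection * C * K.starProjection - (γ : ℂ) • K.starProjection) u, u⟫_ℂ =
          ((⟪u, (K.starProjection * C * K.starProjection -
            (γ : ℂ) • K.starProjection) u⟫_ℂ).re : ℂ) := by
        rw [hS.isSymmetric.apply_clm, eq_comm, ← Complex.conj_eq_iff_re, inner_conj_symm,
          hS.isSymmetric.apply_clm]
      rw [h3, Complex.zero_le_real]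
      linarith

omit [CompleteSpace H] in
/-- Two bounded commutators with the same densely defined operator agree. -/
lemma IsBoundedCommutator.unique {T : H →L[ℂ] H} {A : H →ₗ.[ℂ] H} {C C' : H →L[ℂ] H}
    (hA : Dense (A.domain : Set H)) (h : IsBoundedCommutator T A C)
    (h' : IsBoundedCommutator T A C') : C = C' := by
  refine ContinuousLinearMap.coeFn_injective (Continuous.ext_on hA C.continuous C'.continuous ?_)
  intro φ hφ
  refine hA.eq_of_inner_right ℂ fun ψ hψ => ?_
  exact (h ⟨ψ, hψ⟩ ⟨φ, hφ⟩).trans (h' ⟨ψ, hψ⟩ ⟨φ, hφ⟩).symm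

omit [CompleteSpace H] in
lemma IsBoundedCommutator.neg {T : H →L[ℂ] H} {A : H →ₗ.[ℂ] H} {C : H →L[ℂ] H}
    (h : IsBoundedCommutator T A C) : IsBoundedCommutator T (-A) (-C) := by
  intro ψ φ
  have := h ψ φ
  simp only [LinearPMap.neg_apply, inner_neg_left, inner_neg_right, neg_apply]
  refine (congrArg Neg.neg this).trans ?_
  ring

/-- The energies with a strict Mourre estimate, in terms of symbols: `T = Φ(f)` and
`[T, iA]_∘ = Φ(g)`. -/
theorem mem_mourreSetPlus_iff (hΦ : Function.Injective Φ) {f g : C(X, ℝ)} {A : H →ₗ.[ℂ] H}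
    (hA : Dense (A.domain : Set H))
    (hg : IsBoundedCommutator (Φ (toComplex f)) A (Φ (toComplex g))) (E : ℝ) :
    E ∈ mourreSetPlus (Φ (toComplex f)) A ↔
      (∃ x, f x = E) ∧ ∀ x, f x = E → 0 < g x := by
  have hgs : IsSelfAdjoint (Φ (toComplex g)) := by
    have : IsSelfAdjoint (toComplex g) := star_toComplex g
    exact this.map Φ
  rw [mourreSetPlus, Set.mem_ofPred_eq, mem_spectrum_symbol Φ hΦ]
  refine and_congr_right fun hex => ?_
  constructor
  · rintro ⟨a, b, γ, hE, hγ, C, hC, hle⟩ x hx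
    -- The commutator in the estimate is some bounded operator; density of the domain identifies it
    -- with `Φ(g)`.
    obtain rfl := hC.unique hA hg
    rw [spectralProjection, smul_starProjection_le_iff hgs] at hle
    have hδ : 0 < min (E - a) (b - E) := lt_min (sub_pos.2 hE.1) (sub_pos.2 hE.2)
    set δ := min (E - a) (b - E) with hδdef
    have hvan : ∀ y, y ∉ Set.Ioo a b → tent E δ y = 0 := by
      intro y hy
      apply tent_eq_zero
      by_contra! hlt
      rw [abs_lt] at hlt
      have h1 := min_le_left (E - a) (b - E)
      have h2 := min_le_right (E - a) (b - E)
      exact hy ⟨by linarith, by linarith⟩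
    let k : C(X, ℝ) := (tent E δ).comp f
    -- Applied to `Φ(k) u`, which lies in the spectral subspace, the estimate says that the symbol
    -- `k² (g - γ)` has a nonnegative form. It is thus nonnegative pointwise, and `k x > 0`.
    have hpos : ∀ u, 0 ≤ (⟪u, Φ (toComplex (k * (g * k - γ • k))) u⟫_ℂ).re := by
      intro u
      have h1 := hle _ (cfc_apply_mem_spectralSubspace (Φ (toComplex f)) hvan u)
      rw [cfc_symbol] at h1
      have h2 : toComplex (γ • k) = (γ : ℂ) • toComplex k := by ext; simp
      rw [inner_symbol_mul, toComplex_sub, toComplex_mul,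
        map_sub, map_mul, h2, map_smul, sub_apply, inner_sub_right,
        smul_apply, inner_smul_right, inner_self_eq_norm_sq_to_K,
        Complex.sub_re]
      have h3 : ((γ : ℂ) * ((‖Φ (toComplex k) u‖ : ℝ) : ℂ) ^ 2).re =
          γ * ‖Φ (toComplex k) u‖ ^ 2 := by
        rw [← Complex.ofReal_pow, ← Complex.ofReal_mul, Complex.ofReal_re]
      have h4 : γ * ‖Φ (toComplex k) u‖ ^ 2 ≤
        (⟪Φ (toComplex k) u, Φ (toComplex g) (Φ (toComplex k) u)⟫_ℂ).re := h1
      change 0 ≤ _ - ((γ : ℂ) * ((‖Φ (toComplex k) u‖ : ℝ) : ℂ) ^ 2).re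
      rw [h3]
      exact sub_nonneg.2 h4
    have h := nonneg_of_inner_symbol_nonneg Φ hΦ hpos x
    have hk : 0 < k x := by
      simp only [k, ContinuousMap.comp_apply, hx]; exact tent_self hδ
    have h2 : 0 ≤ k x * (k x * (g x - γ)) := by
      refine h.trans_eq ?_
      simp only [ContinuousMap.mul_apply, ContinuousMap.sub_apply, ContinuousMap.smul_apply,
        smul_eq_mul]
      ring
    have h3 := (mul_nonneg_iff_of_pos_left hk).1 ((mul_nonneg_iff_of_pos_left hk).1 h2)
    linarith
  · intro h
    obtain ⟨x₀, hx₀⟩ := hex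
    have hcomp : IsCompact (f ⁻¹' {E}) := (isClosed_singleton.preimage f.continuous).isCompact
    obtain ⟨x₁, hx₁, hmin⟩ := hcomp.exists_isMinOn ⟨x₀, hx₀⟩ g.continuous.continuousOn
    have hg₁ : 0 < g x₁ := h x₁ hx₁
    -- Half the minimum of `g` on the level set: the compact set `{g ≤ γ}` misses the level set, so
    -- its image under `f` stays a distance `ε` from `E`.
    set γ := g x₁ / 2 with hγ
    have hK : IsClosed (f '' {x | g x ≤ γ}) :=
      ((isClosed_le g.continuous continuous_const).isCompact.image f.continuous).isClosed
    have hEK : E ∈ (f '' {x | g x ≤ γ})ᶜ := by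
      rintro ⟨x, hx, hfx⟩
      have h1 : g x₁ ≤ g x := hmin (show x ∈ f ⁻¹' {E} from hfx)
      have h2 : g x ≤ γ := hx
      linarith
    obtain ⟨ε, hε, hball⟩ := Metric.isOpen_iff.1 hK.isOpen_compl E hEK
    have hε2 : 0 < ε / 2 := by linarith
    -- The radius `ε / 2` leaves room for a plateau that is 1 on the interval and vanishes at
    -- distance `ε`; where it is nonzero, `g > γ`.
    refine ⟨E - ε / 2, E + ε / 2, γ, ⟨by linarith, by linarith⟩, by linarith, _, hg, ?_⟩
    rw [spectralProjection, smul_starProjection_le_iff hgs]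
    intro u hu
    have hfix := apply_eq_self_of_mem_spectralSubspace (χ := plateau E (ε / 2))
      (fun y hy => plateau_eq_one hε2 (abs_le.2 ⟨by linarith [hy.1], by linarith [hy.2]⟩)) hu
    rw [cfc_symbol] at hfix
    let k : C(X, ℝ) := (plateau E (ε / 2)).comp f
    have hkn : ∀ x, 0 ≤ (k * (g * k - γ • k)) x := by
      intro x
      have hx : 0 ≤ k x * k x * (g x - γ) := by
        by_cases hgx : g x ≤ γ
        · have : k x = 0 := by
            apply plateau_eq_zero hε2
            by_contra! hlt
            exact hball (show f x ∈ Metric.ball E ε by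
              rw [Metric.mem_ball, Real.dist_eq]; linarith) ⟨x, hgx, rfl⟩
          simp [this]
        · exact mul_nonneg (mul_self_nonneg _) (by linarith)
      refine hx.trans_eq ?_
      simp only [ContinuousMap.mul_apply, ContinuousMap.sub_apply, ContinuousMap.smul_apply,
        smul_eq_mul]
      ring
    have h1 := inner_symbol_nonneg Φ hkn u
    have h2 : toComplex (γ • k) = (γ : ℂ) • toComplex k := by ext; simp
    have hfix' : Φ (toComplex k) u = u := hfix
    rw [inner_symbol_mul, toComplex_sub, toComplex_mul,
      map_sub, map_mul, h2, map_smul, sub_apply, inner_sub_right,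
      smul_apply, inner_smul_right, mul_apply_eq_comp, hfix',
      inner_self_eq_norm_sq_to_K, Complex.sub_re] at h1
    have h3 : ((γ : ℂ) * ((‖u‖ : ℝ) : ℂ) ^ 2).re = γ * ‖u‖ ^ 2 := by
      rw [← Complex.ofReal_pow, ← Complex.ofReal_mul, Complex.ofReal_re]
    rw [← h3]
    exact sub_nonneg.1 h1

end Criterion

open MeasureTheory

/-! ### Multiplication operators on `L²` -/

section Multiplication

variable {X : Type*} [TopologicalSpace X] [CompactSpace X] [MeasurableSpace X] [BorelSpace X]
  (μ : Measure X) [IsFiniteMeasure μ]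

/-- Multiplication by a continuous function on `L²`. -/
def mulOp (f : C(X, ℂ)) : Lp ℂ 2 μ →L[ℂ] Lp ℂ 2 μ :=
  (ContinuousLinearMap.mul ℂ ℂ).holderL μ ∞ 2 2 (f.toLp ∞ μ ℂ)

lemma coeFn_mulOp (f : C(X, ℂ)) (u : Lp ℂ 2 μ) : mulOp μ f u =ᵐ[μ] fun x => f x * u x := by
  have h := (ContinuousLinearMap.mul ℂ ℂ).coeFn_holder (r := 2) (f.toLp ∞ μ ℂ) u
  filter_upwards [h, ContinuousMap.coeFn_toLp (p := ∞) (𝕜 := ℂ) μ f] with x h1 h2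
  refine h1.trans ?_
  rw [h2]; rfl

/-- Multiplication by continuous functions on `L²`, as a representation. -/
def mulHom : C(X, ℂ) →⋆ₐ[ℂ] (Lp ℂ 2 μ →L[ℂ] Lp ℂ 2 μ) where
  toFun := mulOp μ
  map_one' := by
    ext1 u
    refine Lp.ext ?_
    filter_upwards [coeFn_mulOp μ 1 u] with x h1
    simpa using h1
  map_mul' f g := by
    ext1 u
    refine Lp.ext ?_
    rw [mul_apply_eq_comp]
    filter_upwards [coeFn_mulOp μ (f * g) u, coeFn_mulOp μ g u, coeFn_mulOp μ f (mulOp μ g u)]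
      with x h1 h2 h3
    rw [h1, h3, h2, ContinuousMap.mul_apply, mul_assoc]
  map_zero' := by simp [mulOp]
  map_add' f g := by simp [mulOp]
  commutes' c := by
    ext1 u
    refine Lp.ext ?_
    rw [Algebra.algebraMap_eq_smul_one, Algebra.algebraMap_eq_smul_one]
    filter_upwards [coeFn_mulOp μ (c • 1) u, Lp.coeFn_smul c u] with x h1 h2
    simpa [h2] using h1
  map_star' f := by
    rw [ContinuousLinearMap.star_eq_adjoint, ContinuousLinearMap.eq_adjoint_iff]
    intro u v
    rw [L2.inner_def, L2.inner_def]
    refine integral_congr_ae ?_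
    filter_upwards [coeFn_mulOp μ (star f) u, coeFn_mulOp μ f v] with x h1 h2
    rw [h1, h2]
    simp [RCLike.inner_apply]
    ring

lemma mulHom_toLp (f g : C(X, ℂ)) :
    mulHom μ f (g.toLp 2 μ ℂ) = (f * g).toLp 2 μ ℂ := by
  refine Lp.ext ?_
  filter_upwards [coeFn_mulOp μ f (g.toLp 2 μ ℂ), ContinuousMap.coeFn_toLp (p := 2) (𝕜 := ℂ) μ g,
    ContinuousMap.coeFn_toLp (p := 2) (𝕜 := ℂ) μ (f * g)] with x h1 h2 h3
  rw [h3, ContinuousMap.mul_apply, ← h2]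
  exact h1

lemma mulHom_injective [μ.IsOpenPosMeasure] : Function.Injective (mulHom μ) := by
  intro f g h
  have h1 := congrArg (fun S : Lp ℂ 2 μ →L[ℂ] Lp ℂ 2 μ => S ((1 : C(X, ℂ)).toLp 2 μ ℂ)) h
  simp only [mulHom_toLp, mul_one] at h1
  exact ContinuousMap.toLp_injective μ h1

end Multiplication

/-! ### Fourier transform and convolution operators -/

section Torus

/-- The normalised Haar measure on the circle `ℝ / ℤ`. -/
local instance haarMeasureSpace : MeasureSpace UnitAddCircle := ⟨AddCircle.haarAddCircle⟩

local instance isAddHaarMeasure_volume : Measure.IsAddHaarMeasure (volume : Measure UnitAddCircle) :=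
  inferInstanceAs (Measure.IsAddHaarMeasure AddCircle.haarAddCircle)

local instance isProbabilityMeasure_volume : IsProbabilityMeasure (volume : Measure UnitAddCircle) :=
  inferInstanceAs (IsProbabilityMeasure AddCircle.haarAddCircle)

variable {d : ℕ}

/-- The torus `(ℝ / ℤ)^d`. -/
abbrev Torus (d : ℕ) : Type := UnitAddTorus (Fin d)

/-- The Fourier transform of `ℓ²(ℤ^d)`. -/
def fourierIso (d : ℕ) : Lp ℂ 2 (volume : Measure (Torus d)) ≃ₗᵢ[ℂ] L2Z d :=
  (UnitAddTorus.mFourierBasis (d := Fin d)).repr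

/-- The convolution operator on `ℓ²(ℤ^d)` with a given continuous symbol on the torus. -/
def symbolOp (d : ℕ) : C(Torus d, ℂ) →⋆ₐ[ℂ] (L2Z d →L[ℂ] L2Z d) :=
  ((fourierIso d).conjStarAlgEquiv : _ →⋆ₐ[ℂ] _).comp (mulHom volume)

lemma symbolOp_injective (d : ℕ) : Function.Injective (symbolOp d) := by
  have : Function.Injective ((fourierIso d).conjStarAlgEquiv) := (fourierIso d).conjStarAlgEquiv.toEquiv.injective
  exact this.comp (mulHom_injective volume)

lemma star_mFourier_mul_mFourier (m n : Fin d → ℤ) :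
    star (UnitAddTorus.mFourier m) * UnitAddTorus.mFourier n = UnitAddTorus.mFourier (n - m) := by
  ext x
  rw [sub_eq_add_neg, UnitAddTorus.mFourier_add, UnitAddTorus.mFourier_neg, mul_comm]
  rfl

/-- Fourier coefficients are inner products with characters, and the adjoint of multiplication by
the character `m` turns the character `n` into `n - m`. -/
lemma symbolOp_mFourier_apply (m n : Fin d → ℤ) (u : L2Z d) :
    (symbolOp d (UnitAddTorus.mFourier m) u : (Fin d → ℤ) → ℂ) n = u (n - m) := by
  have key : ∀ k (w : Lp ℂ 2 (volume : Measure (Torus d))), (fourierIso d w) k =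
      ⟪(UnitAddTorus.mFourier k).toLp 2 (volume : Measure (Torus d)) ℂ, w⟫_ℂ := by
    intro k w
    have h := UnitAddTorus.mFourierBasis.repr_apply_apply w k
    rw [UnitAddTorus.coe_mFourierBasis] at h
    exact h
  set w := (fourierIso d).symm u with hw
  have h1 : symbolOp d (UnitAddTorus.mFourier m) u =
      fourierIso d (mulHom volume (UnitAddTorus.mFourier m) w) := rfl
  have h2 : u = fourierIso d w := by rw [hw, LinearIsometryEquiv.apply_symm_apply]
  rw [h1, h2, key, key, ← star_mFourier_mul_mFourier, ← mulHom_toLp, map_star,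
    ContinuousLinearMap.star_eq_adjoint, ContinuousLinearMap.adjoint_inner_left]

lemma symbolOp_mFourier_single (j : Fin d) (k : ℤ) :
    symbolOp d (UnitAddTorus.mFourier (Pi.single j k)) = shift j k := by
  ext u n
  exact symbolOp_mFourier_apply _ _ _

end Torus

open UnitAddTorus

/-! ### Commutators on arbitrary sequences -/

section SequenceCommutators

variable {d : ℕ}

lemma seqShift_mul_seqShift (i j : Fin d) (k l : ℤ) :
    seqShift i k * seqShift j l = seqShift j l * seqShift i k := by
  ext u n
  change u (n - Pi.single i k - Pi.single j l) = u (n - Pi.single j l - Pi.single i k)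
  rw [sub_right_comm]

lemma seqPos_mul_seqShift_self (j : Fin d) (k : ℤ) :
    seqPos j * seqShift j k = seqShift j k * seqPos j + (k : ℂ) • seqShift j k := by
  ext u n
  change (n j : ℂ) * u (n - Pi.single j k) =
    ((n - Pi.single j k : Fin d → ℤ) j : ℂ) * u (n - Pi.single j k) +
      k * u (n - Pi.single j k)
  simp
  ring

lemma seqPos_mul_seqShift_of_ne {i j : Fin d} (h : i ≠ j) (k : ℤ) :
    seqPos i * seqShift j k = seqShift j k * seqPos i := by
  ext u n
  change (n i : ℂ) * u (n - Pi.single j k) =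
    ((n - Pi.single j k : Fin d → ℤ) i : ℂ) * u (n - Pi.single j k)
  simp [h]

/-- Shifts commute with each other, and `N_j S_j^k = S_j^k N_j + k S_j^k`, so only the `j`-th
summand contributes, with one factor `k` from each of its two orderings. On arbitrary sequences all
the operators are everywhere defined and no domain question arises. -/
lemma commutator_seqShift_seqConj (κ : Fin d → ℕ) (j : Fin d) (k : ℤ) :
    Complex.I • (seqShift j k * seqConj κ - seqConj κ * seqShift j k) =
      (-(k / 2) : ℂ) • ((seqShift j (κ j) - seqShift j (-(κ j : ℤ))) * seqShift j k) := by
  have hW : ∀ i, (seqShift i (κ i) - seqShift i (-(κ i : ℤ))) * seqShift j k =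
      seqShift j k * (seqShift i (κ i) - seqShift i (-(κ i : ℤ))) := by
    intro i
    rw [sub_mul, mul_sub, seqShift_mul_seqShift, seqShift_mul_seqShift i j]
  have hdef : seqConj κ = ∑ i, (1 / (4 * Complex.I)) •
      ((seqShift i (κ i) - seqShift i (-(κ i : ℤ))) * seqPos i +
        seqPos i * (seqShift i (κ i) - seqShift i (-(κ i : ℤ)))) := rfl
  rw [hdef, Finset.mul_sum, Finset.sum_mul, ← Finset.sum_sub_distrib,
    Finset.sum_eq_single_of_mem j (Finset.mem_univ j)]
  · have h := hW j
    set W := seqShift j (κ j) - seqShift j (-(κ j : ℤ))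
    have hN := seqPos_mul_seqShift_self j k
    set N := seqPos j
    set S := seqShift j k
    have h1 : W * N * S = S * (W * N) + (k : ℂ) • (W * S) := by
      rw [mul_assoc, hN, mul_add, ← mul_assoc, h, mul_assoc, mul_smul_comm, h]
    have h2 : N * W * S = S * (N * W) + (k : ℂ) • (W * S) := by
      rw [mul_assoc, h, ← mul_assoc, hN, add_mul, mul_assoc, smul_mul_assoc]
    rw [mul_smul_comm, smul_mul_assoc, mul_add, add_mul, h1, h2]
    have h4 : ∀ (c : ℂ) (x y : Module.End ℂ ((Fin d → ℤ) → ℂ)), c • x - c • y = c • (x - y) :=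
      fun c x y => (smul_sub c x y).symm
    have h3 : S * (W * N) + S * (N * W) - (S * (W * N) + (k : ℂ) • (W * S) +
        (S * (N * W) + (k : ℂ) • (W * S))) = (-2 * k : ℂ) • (W * S) := by
      rw [mul_smul, neg_smul, two_smul]; abel
    rw [h4, h3, smul_smul, smul_smul]
    congr 1
    field_simp
    ring
  · intro i _ hij
    have h := hW i
    set W := seqShift i (κ i) - seqShift i (-(κ i : ℤ))
    have hN := seqPos_mul_seqShift_of_ne hij k
    set N := seqPos i
    set S := seqShift j k
    have h1 : W * N * S = S * (W * N) := by rw [mul_assoc, hN, ← mul_assoc, h, mul_assoc]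
    have h2 : N * W * S = S * (N * W) := by rw [mul_assoc, h, ← mul_assoc, hN, mul_assoc]
    rw [mul_smul_comm, smul_mul_assoc, mul_add, add_mul, h1, h2, sub_self]

end SequenceCommutators

/-! ### Commutator calculus for symbols -/

section SymbolCommutators

variable {d : ℕ}

/-- The convolution operator with symbol `f` acts on arbitrary sequences, preserves the finitely
supported ones, and its commutator with `i A_κ` is the convolution operator with symbol `g`. -/
def HasCommutator (κ : Fin d → ℕ) (f g : C(Torus d, ℂ)) : Prop :=
  ∃ t s : Module.End ℂ ((Fin d → ℤ) → ℂ),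
    (∀ u : L2Z d, (symbolOp d f u : (Fin d → ℤ) → ℂ) = t u) ∧
    (∀ u : L2Z d, (symbolOp d g u : (Fin d → ℤ) → ℂ) = s u) ∧
    (∀ u ∈ finSeq d, t u ∈ finSeq d) ∧ Complex.I • (t * seqConj κ - seqConj κ * t) = s

variable {κ : Fin d → ℕ} {f₁ f₂ g₁ g₂ : C(Torus d, ℂ)}

lemma HasCommutator.add (h₁ : HasCommutator κ f₁ g₁) (h₂ : HasCommutator κ f₂ g₂) :
    HasCommutator κ (f₁ + f₂) (g₁ + g₂) := by
  obtain ⟨t₁, s₁, ht₁, hs₁, hf₁, hc₁⟩ := h₁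
  obtain ⟨t₂, s₂, ht₂, hs₂, hf₂, hc₂⟩ := h₂
  refine ⟨t₁ + t₂, s₁ + s₂, fun u => ?_, fun u => ?_,
    fun u hu => (finSeq d).add_mem (hf₁ u hu) (hf₂ u hu), ?_⟩
  · rw [map_add, add_apply, lp.coeFn_add, ht₁, ht₂, LinearMap.add_apply]
  · rw [map_add, add_apply, lp.coeFn_add, hs₁, hs₂, LinearMap.add_apply]
  · rw [← hc₁, ← hc₂, ← smul_add, add_mul, mul_add]
    congr 1
    abel

lemma HasCommutator.smul (c : ℂ) (h₁ : HasCommutator κ f₁ g₁) :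
    HasCommutator κ (c • f₁) (c • g₁) := by
  obtain ⟨t₁, s₁, ht₁, hs₁, hf₁, hc₁⟩ := h₁
  refine ⟨c • t₁, c • s₁, fun u => ?_, fun u => ?_,
    fun u hu => (finSeq d).smul_mem c (hf₁ u hu), ?_⟩
  · rw [map_smul, smul_apply, lp.coeFn_smul, ht₁, LinearMap.smul_apply]
  · rw [map_smul, smul_apply, lp.coeFn_smul, hs₁, LinearMap.smul_apply]
  · have h : ∀ x y : Module.End ℂ ((Fin d → ℤ) → ℂ), c • x - c • y = c • (x - y) :=
      fun x y => (smul_sub c x y).symm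
    rw [← hc₁, smul_mul_assoc, mul_smul_comm, h, smul_comm]

/-- The Leibniz rule: commutation with `A_κ` is a derivation. -/
lemma HasCommutator.mul (h₁ : HasCommutator κ f₁ g₁) (h₂ : HasCommutator κ f₂ g₂) :
    HasCommutator κ (f₁ * f₂) (f₁ * g₂ + g₁ * f₂) := by
  obtain ⟨t₁, s₁, ht₁, hs₁, hf₁, hc₁⟩ := h₁
  obtain ⟨t₂, s₂, ht₂, hs₂, hf₂, hc₂⟩ := h₂
  refine ⟨t₁ * t₂, t₁ * s₂ + s₁ * t₂, fun u => ?_, fun u => ?_,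
    fun u hu => hf₁ _ (hf₂ u hu), ?_⟩
  · rw [map_mul, mul_apply_eq_comp, ht₁, ht₂, Module.End.mul_apply]
  · rw [map_add, add_apply, lp.coeFn_add, map_mul, map_mul, mul_apply_eq_comp, mul_apply_eq_comp,
      ht₁, hs₁, ht₂, hs₂, LinearMap.add_apply, Module.End.mul_apply, Module.End.mul_apply]
  · rw [← hc₁, ← hc₂, mul_smul_comm, smul_mul_assoc, ← smul_add]
    congr 1
    simp only [mul_sub, sub_mul, mul_assoc]
    abel

lemma HasCommutator.one : HasCommutator κ 1 0 := by
  refine ⟨1, 0, fun u => ?_, fun u => ?_, fun u hu => hu, ?_⟩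
  · rw [map_one]; rfl
  · rw [map_zero]; rfl
  · rw [one_mul, mul_one, sub_self, smul_zero]

lemma HasCommutator.prod {ι : Type*} [DecidableEq ι] (s : Finset ι) {f g : ι → C(Torus d, ℂ)}
    (h : ∀ i, HasCommutator κ (f i) (g i)) :
    HasCommutator κ (∏ i ∈ s, f i) (∑ j ∈ s, (∏ i ∈ s.erase j, f i) * g j) := by
  induction s using Finset.induction_on with
  | empty => simpa using HasCommutator.one
  | insert a s ha ih =>
    have h1 := (h a).mul ih
    rw [Finset.prod_insert ha]
    convert h1 using 1
    rw [Finset.sum_insert ha, Finset.erase_insert ha, add_comm, Finset.mul_sum, mul_comm (g a)]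
    congr 1
    refine Finset.sum_congr rfl fun j hj => ?_
    have hja : a ≠ j := fun h => ha (h ▸ hj)
    rw [Finset.erase_insert_of_ne hja, Finset.prod_insert (fun h => ha (Finset.mem_of_mem_erase h)),
      mul_assoc]

/-- The symbol of `S_j^k`. -/
def shiftSymbol (j : Fin d) (k : ℤ) : C(Torus d, ℂ) := mFourier (Pi.single j k)

lemma symbolOp_shiftSymbol (j : Fin d) (k : ℤ) : symbolOp d (shiftSymbol j k) = shift j k :=
  symbolOp_mFourier_single j k

lemma hasCommutator_shiftSymbol (κ : Fin d → ℕ) (j : Fin d) (k : ℤ) :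
    HasCommutator κ (shiftSymbol j k) ((-(k / 2) : ℂ) •
      ((shiftSymbol j (κ j) - shiftSymbol j (-(κ j : ℤ))) * shiftSymbol j k)) := by
  refine ⟨seqShift j k, _, fun u => ?_, fun u => ?_, fun u hu => seqShift_mem_finSeq j k hu,
    commutator_seqShift_seqConj κ j k⟩
  · rw [symbolOp_shiftSymbol]; rfl
  · rw [map_smul, map_mul, map_sub, symbolOp_shiftSymbol, symbolOp_shiftSymbol,
      symbolOp_shiftSymbol]
    rfl

/-- The symbol of `Δ_j`. -/
def lapSymbol (j : Fin d) : C(Torus d, ℂ) :=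
  (1 / 2 : ℂ) • (shiftSymbol j 1 + shiftSymbol j (-1))

/-- The symbol of `[Δ_j, i A_κ]`. -/
def lapCommSymbol (κ : Fin d → ℕ) (j : Fin d) : C(Torus d, ℂ) :=
  (-1 / 4 : ℂ) • ((shiftSymbol j (κ j) - shiftSymbol j (-(κ j : ℤ))) *
    (shiftSymbol j 1 - shiftSymbol j (-1)))

lemma hasCommutator_lapSymbol (κ : Fin d → ℕ) (j : Fin d) :
    HasCommutator κ (lapSymbol j) (lapCommSymbol κ j) := by
  have h := ((hasCommutator_shiftSymbol κ j 1).add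
    (hasCommutator_shiftSymbol κ j (-1))).smul (1 / 2 : ℂ)
  have hg : lapCommSymbol κ j = (1 / 2 : ℂ) •
      ((-((1 : ℤ) / 2) : ℂ) • ((shiftSymbol j (κ j) - shiftSymbol j (-(κ j : ℤ))) *
        shiftSymbol j 1) + (-((-1 : ℤ) / 2) : ℂ) •
        ((shiftSymbol j (κ j) - shiftSymbol j (-(κ j : ℤ))) * shiftSymbol j (-1))) := by
    ext x
    simp [lapCommSymbol]
    ring
  rw [hg]
  exact h

lemma symbolOp_prod_lapSymbol (d : ℕ) : symbolOp d (∏ j, lapSymbol j) = mvLap d := by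
  rw [mvLap, ← List.prod_ofFn, map_list_prod, List.map_ofFn]
  congr 2
  ext1 j
  simp [lapSymbol, lap, symbolOp_shiftSymbol]

end SymbolCommutators

/-! ### From the formal commutator to the closed operator `A_κ` -/

section ConjugateOperator

variable {d : ℕ}

/-- The position operator on finitely supported sequences. -/
def posCore (j : Fin d) (κ : Fin d → ℕ) (u : (conjCore κ).domain) : L2Z d :=
  ⟨seqPos j (u : L2Z d), memlp_of_mem_finSeq (seqPos_mem_finSeq j u.2)⟩

lemma inner_posCore (j : Fin d) (κ : Fin d → ℕ) (u v : (conjCore κ).domain) :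
    ⟪(u : L2Z d), posCore j κ v⟫_ℂ = ⟪posCore j κ u, (v : L2Z d)⟫_ℂ := by
  rw [lp.inner_eq_tsum, lp.inner_eq_tsum]
  refine tsum_congr fun n => ?_
  change (n j : ℂ) * (v : L2Z d) n * star ((u : L2Z d) n) =
    (v : L2Z d) n * star ((n j : ℂ) * (u : L2Z d) n)
  simp
  ring

lemma adjoint_shift (j : Fin d) (k : ℤ) :
    ContinuousLinearMap.adjoint (shift j k) = shift j (-k) := by
  rw [← symbolOp_shiftSymbol, ← symbolOp_shiftSymbol, ← ContinuousLinearMap.star_eq_adjoint,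
    ← map_star]
  congr 1
  ext x
  rw [shiftSymbol, shiftSymbol, Pi.single_neg, mFourier_neg]
  rfl

/-- The difference `S_j^κ - S_j^(-κ)` on finitely supported sequences. -/
def shiftDiffCore (j : Fin d) (κ : Fin d → ℕ) (u : (conjCore κ).domain) : (conjCore κ).domain :=
  ⟨(shift j (κ j) - shift j (-(κ j : ℤ))) (u : L2Z d),
    (finSeq d).sub_mem (seqShift_mem_finSeq j _ u.2) (seqShift_mem_finSeq j _ u.2)⟩

lemma conjCore_apply (κ : Fin d → ℕ) (u : (conjCore κ).domain) :
    conjCore κ u = ∑ j, (1 / (4 * Complex.I)) •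
      ((shift j (κ j) - shift j (-(κ j : ℤ))) (posCore j κ u) +
        posCore j κ (shiftDiffCore j κ u)) := by
  ext n
  rw [lp.coeFn_sum]
  change seqConj κ (u : L2Z d) n = _
  rw [seqConj, LinearMap.sum_apply, Finset.sum_apply, Finset.sum_apply]
  rfl

/-- `W = S_j^κ - S_j^(-κ)` is skew-adjoint and `N_j` symmetric, so passing to the adjoint exchanges
`W N_j` and `N_j W` up to a sign, which the conjugate of the imaginary factor `1 / (4i)` cancels. -/
lemma conjCore_symmetric (κ : Fin d → ℕ) (u v : (conjCore κ).domain) :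
    ⟪(u : L2Z d), conjCore κ v⟫_ℂ = ⟪conjCore κ u, (v : L2Z d)⟫_ℂ := by
  have hW : ∀ (j : Fin d) (x y : L2Z d), ⟪x, (shift j (κ j) - shift j (-(κ j : ℤ))) y⟫_ℂ =
      -⟪(shift j (κ j) - shift j (-(κ j : ℤ))) x, y⟫_ℂ := by
    intro j x y
    rw [← ContinuousLinearMap.adjoint_inner_left, map_sub, adjoint_shift, adjoint_shift, neg_neg,
      ← inner_neg_left, ← neg_apply, neg_sub]
  rw [conjCore_apply, conjCore_apply, inner_sum, sum_inner]
  refine Finset.sum_congr rfl fun j _ => ?_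
  have h1 : ⟪(u : L2Z d), (shift j (κ j) - shift j (-(κ j : ℤ))) (posCore j κ v)⟫_ℂ =
      -⟪posCore j κ (shiftDiffCore j κ u), (v : L2Z d)⟫_ℂ := by
    rw [hW, ← inner_posCore]
    rfl
  have h2 : ⟪(u : L2Z d), posCore j κ (shiftDiffCore j κ v)⟫_ℂ =
      -⟪(shift j (κ j) - shift j (-(κ j : ℤ))) (posCore j κ u), (v : L2Z d)⟫_ℂ := by
    rw [inner_posCore, ← hW]
    rfl
  have hc : (starRingEnd ℂ) (1 / (4 * Complex.I)) = -(1 / (4 * Complex.I)) := by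
    rw [map_div₀, map_mul, Complex.conj_I, map_one, map_ofNat, mul_neg, div_neg]
  rw [inner_smul_left, inner_smul_right, inner_add_left, inner_add_right, h1, h2, hc]
  ring

/-- The operator preserves finitely supported sequences, so `A_κ` may be applied after it; symmetry
of `A_κ` then turns the operator commutator into the form. -/
lemma HasCommutator.isBoundedCommutator_conjCore {κ : Fin d → ℕ} {f : C(Torus d, ℝ)}
    {g : C(Torus d, ℂ)} (h : HasCommutator κ (toComplex f) g) :
    IsBoundedCommutator (symbolOp d (toComplex f)) (conjCore κ) (symbolOp d g) := by
  obtain ⟨t, s, ht, hs, hf, hc⟩ := h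
  intro ψ φ
  have hφ : ((symbolOp d (toComplex f) (φ : L2Z d) : L2Z d) : (Fin d → ℤ) → ℂ) ∈ finSeq d := by
    rw [ht]; exact hf _ φ.2
  let χ : (conjCore κ).domain := ⟨symbolOp d (toComplex f) φ, hφ⟩
  have key : symbolOp d g (φ : L2Z d) =
      Complex.I • (symbolOp d (toComplex f) (conjCore κ φ) - conjCore κ χ) := by
    apply lp.ext
    rw [hs, ← hc, lp.coeFn_smul, lp.coeFn_sub, ht]
    have h1 : (conjCore κ χ : (Fin d → ℤ) → ℂ) = seqConj κ (t (φ : L2Z d)) := by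
      rw [← ht]; rfl
    rw [h1]
    rfl
  rw [key, inner_smul_right, inner_sub_right, conjCore_symmetric,
    ← ContinuousLinearMap.adjoint_inner_left, adjoint_symbol]

/-- The defining identity is a closed condition on pairs of graph points. -/
lemma IsBoundedCommutator.closure {H : Type*} [NormedAddCommGroup H] [InnerProductSpace ℂ H]
    {T : H →L[ℂ] H} {A : H →ₗ.[ℂ] H} {C : H →L[ℂ] H} (h : IsBoundedCommutator T A C) :
    IsBoundedCommutator T A.closure C := by
  have hgraph : ∀ ψ : A.closure.domain,
      ((ψ : H), A.closure ψ) ∈ _root_.closure (A.graph : Set (H × H)) := by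
    intro ψ
    have h1 : ((ψ : H), A.closure ψ) ∈ A.closure.graph := A.closure.mem_graph ψ
    by_cases hA : A.IsClosable
    -- In the non-closable case the closure is `A` itself by convention, so closability need not be
    -- proved.
    · rwa [← hA.graph_closure_eq_closure_graph] at h1
    · have h2 : A.closure.graph = A.graph := by rw [LinearPMap.closure_def' hA]
      exact subset_closure (h2 ▸ h1)
  have hclosed : IsClosed {p : (H × H) × (H × H) |
      ⟪p.1.1, C p.2.1⟫_ℂ = Complex.I * (⟪T p.1.1, p.2.2⟫_ℂ - ⟪p.1.2, T p.2.1⟫_ℂ)} :=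
    isClosed_eq (by fun_prop) (by fun_prop)
  intro ψ φ
  have hmem : (((ψ : H), A.closure ψ), ((φ : H), A.closure φ)) ∈
      _root_.closure ((A.graph : Set (H × H)) ×ˢ (A.graph : Set (H × H))) := by
    rw [closure_prod_eq]
    exact ⟨hgraph ψ, hgraph φ⟩
  refine hclosed.closure_subset_iff.2 ?_ hmem
  rintro ⟨⟨x, a⟩, ⟨y, b⟩⟩ ⟨hx, hy⟩
  obtain ⟨ψ', rfl, rfl⟩ := (LinearPMap.mem_graph_iff A).1 hx
  obtain ⟨φ', rfl, rfl⟩ := (LinearPMap.mem_graph_iff A).1 hy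
  exact h ψ' φ'

lemma dense_domain_conjCore (κ : Fin d → ℕ) : Dense ((conjCore κ).domain : Set (L2Z d)) := by
  intro u
  have h := lp.hasSum_single (p := 2) (by simp) u
  refine mem_closure_of_tendsto h (Filter.Eventually.of_forall fun s => ?_)
  refine (conjCore κ).domain.sum_mem fun n _ => ?_
  change (Function.support _).Finite
  refine (Set.finite_singleton n).subset fun m hm => ?_
  by_contra hne
  exact hm (lp.single_apply_ne (E := fun _ : Fin d → ℤ => ℂ) 2 n (u n) hne)

lemma dense_domain_conjOp (κ : Fin d → ℕ) : Dense ((conjOp κ).domain : Set (L2Z d)) :=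
  (dense_domain_conjCore κ).mono (conjCore κ).le_closure.1

end ConjugateOperator

/-! ### The symbols in terms of angles -/

section SymbolValues

variable {d : ℕ}

/-- The point of the torus with given angles. -/
def torusPoint (a : Fin d → ℝ) : Torus d := fun j => ((a j / (2 * Real.pi) : ℝ) : UnitAddCircle)

lemma torusPoint_surjective : Function.Surjective (torusPoint (d := d)) := by
  intro x
  choose b hb using fun j => QuotientAddGroup.mk_surjective (x j)
  refine ⟨fun j => 2 * Real.pi * b j, funext fun j => ?_⟩
  rw [← hb j, torusPoint, mul_div_cancel_left₀ _ (by positivity)]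

lemma shiftSymbol_torusPoint (j : Fin d) (k : ℤ) (a : Fin d → ℝ) :
    shiftSymbol j k (torusPoint a) =
      (Real.cos (k * a j) : ℂ) + (Real.sin (k * a j) : ℂ) * Complex.I := by
  have h : shiftSymbol j k (torusPoint a) = fourier k (torusPoint a j) := by
    change ∏ i, fourier ((Pi.single j k : Fin d → ℤ) i) (torusPoint a i) = _
    rw [Finset.prod_eq_single_of_mem j (Finset.mem_univ j), Pi.single_eq_same]
    intro i _ hij
    rw [Pi.single_eq_of_ne hij, fourier_zero]
  rw [h, torusPoint, fourier_coe_apply, Complex.ofReal_cos, Complex.ofReal_sin, ← Complex.exp_mul_I]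
  congr 1
  have hpi : (Real.pi : ℂ) ≠ 0 := by exact_mod_cast Real.pi_ne_zero
  push_cast
  field_simp

lemma lapSymbol_torusPoint (j : Fin d) (a : Fin d → ℝ) :
    lapSymbol j (torusPoint a) = (Real.cos (a j) : ℂ) := by
  simp only [lapSymbol, ContinuousMap.smul_apply, ContinuousMap.add_apply, shiftSymbol_torusPoint,
    smul_eq_mul]
  simp
  ring

lemma lapCommSymbol_torusPoint (κ : Fin d → ℕ) (j : Fin d) (a : Fin d → ℝ) :
    lapCommSymbol κ j (torusPoint a) = ((Real.sin (κ j * a j) * Real.sin (a j) : ℝ) : ℂ) := by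
  simp only [lapCommSymbol, ContinuousMap.smul_apply, ContinuousMap.mul_apply,
    ContinuousMap.sub_apply, shiftSymbol_torusPoint, smul_eq_mul, Int.cast_neg, Int.cast_natCast,
    Int.cast_one, neg_mul, one_mul, Real.cos_neg, Real.sin_neg, Complex.ofReal_neg,
    Complex.ofReal_mul]
  linear_combination (-(Real.sin (κ j * a j) : ℂ) * (Real.sin (a j) : ℂ)) * Complex.I_sq

/-- The symbol of `D`. -/
def mvSymbol (d : ℕ) : C(Torus d, ℝ) :=
  ⟨fun x => ((∏ j, lapSymbol j : C(Torus d, ℂ)) x).re, by fun_prop⟩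

/-- The symbol of `[D, i A_κ]`. -/
def commSymbol (κ : Fin d → ℕ) : C(Torus d, ℝ) :=
  ⟨fun x => ((∑ j, (∏ i ∈ Finset.univ.erase j, lapSymbol i) * lapCommSymbol κ j :
    C(Torus d, ℂ)) x).re, by fun_prop⟩

lemma mvSymbol_torusPoint_complex (a : Fin d → ℝ) :
    (∏ j, lapSymbol j : C(Torus d, ℂ)) (torusPoint a) = ((∏ j, Real.cos (a j) : ℝ) : ℂ) := by
  rw [ContinuousMap.prod_apply, Complex.ofReal_prod]
  exact Finset.prod_congr rfl fun j _ => lapSymbol_torusPoint j a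

lemma commSymbol_torusPoint_complex (κ : Fin d → ℕ) (a : Fin d → ℝ) :
    (∑ j, (∏ i ∈ Finset.univ.erase j, lapSymbol i) * lapCommSymbol κ j : C(Torus d, ℂ))
      (torusPoint a) = ((∑ j, (∏ i ∈ Finset.univ.erase j, Real.cos (a i)) *
        (Real.sin (κ j * a j) * Real.sin (a j)) : ℝ) : ℂ) := by
  rw [ContinuousMap.sum_apply, Complex.ofReal_sum]
  refine Finset.sum_congr rfl fun j _ => ?_
  rw [ContinuousMap.mul_apply, ContinuousMap.prod_apply, lapCommSymbol_torusPoint,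
    Complex.ofReal_mul (∏ i ∈ Finset.univ.erase j, Real.cos (a i)), Complex.ofReal_prod]
  congr 1
  exact Finset.prod_congr rfl fun i _ => lapSymbol_torusPoint i a

lemma mvSymbol_torusPoint (a : Fin d → ℝ) : mvSymbol d (torusPoint a) = ∏ j, Real.cos (a j) :=
  congrArg Complex.re (mvSymbol_torusPoint_complex a)

lemma commSymbol_torusPoint (κ : Fin d → ℕ) (a : Fin d → ℝ) :
    commSymbol κ (torusPoint a) = ∑ j, (∏ i ∈ Finset.univ.erase j, Real.cos (a i)) *
        (Real.sin (κ j * a j) * Real.sin (a j)) :=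
  congrArg Complex.re (commSymbol_torusPoint_complex κ a)

lemma toComplex_mvSymbol (d : ℕ) : toComplex (mvSymbol d) = ∏ j, lapSymbol j := by
  ext x
  obtain ⟨a, rfl⟩ := torusPoint_surjective x
  rw [toComplex_apply, mvSymbol_torusPoint, mvSymbol_torusPoint_complex]

lemma toComplex_commSymbol (κ : Fin d → ℕ) : toComplex (commSymbol κ) =
    ∑ j, (∏ i ∈ Finset.univ.erase j, lapSymbol i) * lapCommSymbol κ j := by
  ext x
  obtain ⟨a, rfl⟩ := torusPoint_surjective x
  rw [toComplex_apply, commSymbol_torusPoint, commSymbol_torusPoint_complex]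

end SymbolValues

/-! ### Reduction to the sign of a sum on `∏ t_i = E²` -/

section MourreSet

variable {d : ℕ}

lemma isBoundedCommutator_conjOp (κ : Fin d → ℕ) :
    IsBoundedCommutator (symbolOp d (toComplex (mvSymbol d))) (conjOp κ)
      (symbolOp d (toComplex (commSymbol κ))) := by
  refine IsBoundedCommutator.closure (HasCommutator.isBoundedCommutator_conjCore ?_)
  rw [toComplex_mvSymbol, toComplex_commSymbol]
  exact HasCommutator.prod Finset.univ (hasCommutator_lapSymbol κ)

/-- The Mourre set of `D` with respect to `A_κ`, in terms of the symbols. -/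
lemma mem_mourreSet_mvLap_iff (κ : Fin d → ℕ) (E : ℝ) :
    E ∈ mourreSet (mvLap d) (conjOp κ) ↔ (∃ a : Fin d → ℝ, ∏ j, Real.cos (a j) = E) ∧
      ((∀ a : Fin d → ℝ, ∏ j, Real.cos (a j) = E →
        0 < ∑ j, (∏ i ∈ Finset.univ.erase j, Real.cos (a i)) *
          (Real.sin (κ j * a j) * Real.sin (a j))) ∨
      (∀ a : Fin d → ℝ, ∏ j, Real.cos (a j) = E →
        ∑ j, (∏ i ∈ Finset.univ.erase j, Real.cos (a i)) *
          (Real.sin (κ j * a j) * Real.sin (a j)) < 0)) := by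
  have hneg : symbolOp d (toComplex (-commSymbol κ)) = -symbolOp d (toComplex (commSymbol κ)) := by
    rw [toComplex_neg, map_neg]
  have h1 := mem_mourreSetPlus_iff (symbolOp d) (symbolOp_injective d) (dense_domain_conjOp κ)
    (isBoundedCommutator_conjOp κ) E
  have h2 := mem_mourreSetPlus_iff (symbolOp d) (symbolOp_injective d) (A := -conjOp κ)
    (dense_domain_conjOp κ) (hneg ▸ (isBoundedCommutator_conjOp κ).neg) E
  rw [mourreSet, ← symbolOp_prod_lapSymbol, ← toComplex_mvSymbol, Set.mem_union, h1, h2,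
    ← and_or_left]
  simp only [torusPoint_surjective.exists, torusPoint_surjective.forall, mvSymbol_torusPoint,
    ContinuousMap.neg_apply, commSymbol_torusPoint, neg_pos]

/-- The factor `cos (a j)` split off by `h` fills the gap in the product over `i ≠ j`; nothing is
divided, so vanishing cosines are allowed. -/
lemma sum_commutator_eq {κ : ℕ} {h : ℝ → ℝ}
    (hh : ∀ a, Real.sin (κ * a) * Real.sin a = Real.cos a * h (Real.cos a ^ 2))
    (a : Fin d → ℝ) :
    ∑ j, (∏ i ∈ Finset.univ.erase j, Real.cos (a i)) * (Real.sin (κ * a j) * Real.sin (a j)) =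
      (∏ j, Real.cos (a j)) * ∑ j, h (Real.cos (a j) ^ 2) := by
  rw [Finset.mul_sum]
  refine Finset.sum_congr rfl fun j _ => ?_
  rw [hh, ← mul_assoc, Finset.prod_erase_mul _ _ (Finset.mem_univ j)]

/-- Every point of the cube with the right product comes from an energy surface of `D`. -/
lemma exists_angles {n : ℕ} {E : ℝ} {t : Fin (n + 1) → ℝ} (ht : ∀ i, t i ∈ Set.Icc (0 : ℝ) 1)
    (hE : ∏ i, t i = E ^ 2) :
    ∃ a : Fin (n + 1) → ℝ, ∏ j, Real.cos (a j) = E ∧ ∀ j, Real.cos (a j) ^ 2 = t j := by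
  have hs : ∀ i, √(t i) ^ 2 = t i := fun i => Real.sq_sqrt (ht i).1
  have hs1 : ∀ i, √(t i) ≤ 1 := fun i => Real.sqrt_le_one.2 (ht i).2
  have hs0 : ∀ i, 0 ≤ √(t i) := fun i => Real.sqrt_nonneg _
  have hprod : (∏ i, √(t i)) ^ 2 = E ^ 2 := by
    rw [← Finset.prod_pow, ← hE]
    exact Finset.prod_congr rfl fun i _ => hs i
  have hcos : ∀ i, Real.cos (Real.arccos √(t i)) = √(t i) := fun i =>
    Real.cos_arccos (by linarith [hs0 i]) (hs1 i)
  rcases sq_eq_sq_iff_eq_or_eq_neg.1 hprod with h | h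
  · refine ⟨fun i => Real.arccos √(t i), ?_, fun j => ?_⟩
    · rw [← h]; exact Finset.prod_congr rfl fun i _ => hcos i
    · rw [hcos, hs]
  -- A wrong overall sign is corrected by reflecting the first angle alone.
  · refine ⟨Fin.cons (Real.pi - Real.arccos √(t 0)) fun i => Real.arccos √(t i.succ), ?_,
      fun j => ?_⟩
    · rw [Fin.prod_univ_succ] at h ⊢
      simp only [Fin.cons_zero, Fin.cons_succ, Real.cos_pi_sub, hcos]
      linarith
    · refine Fin.cases ?_ (fun i => ?_) j
      · simp only [Fin.cons_zero, Real.cos_pi_sub, hcos, neg_sq, hs]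
      · simp only [Fin.cons_succ, hcos, hs]

lemma exists_prod_cos_eq_iff {n : ℕ} (E : ℝ) :
    (∃ a : Fin (n + 1) → ℝ, ∏ j, Real.cos (a j) = E) ↔ |E| ≤ 1 := by
  constructor
  · rintro ⟨a, rfl⟩
    rw [Finset.abs_prod]
    exact Finset.prod_le_one (fun _ _ => abs_nonneg _) fun _ _ => Real.abs_cos_le_one _
  · intro h
    refine ⟨Fin.cons (Real.arccos E) fun _ => 0, ?_⟩
    rw [Fin.prod_univ_succ]
    simp [Real.cos_arccos (abs_le.1 h).1 (abs_le.1 h).2]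

/-- The set `μ_{A_κ}(D)` in terms of the function `h` with `[Δ_j, i A_κ] = Δ_j h(Δ_j²)`. -/
theorem mem_mu_iff {n κ : ℕ} {h : ℝ → ℝ}
    (hh : ∀ a, Real.sin (κ * a) * Real.sin a = Real.cos a * h (Real.cos a ^ 2)) (E : ℝ) :
    E ∈ mu (n + 1) κ ↔ |E| ≤ 1 ∧ E ≠ 0 ∧
      ((∀ t : Fin (n + 1) → ℝ, (∀ i, t i ∈ Set.Icc (0 : ℝ) 1) → ∏ i, t i = E ^ 2 →
        0 < ∑ i, h (t i)) ∨
      (∀ t : Fin (n + 1) → ℝ, (∀ i, t i ∈ Set.Icc (0 : ℝ) 1) → ∏ i, t i = E ^ 2 →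
        ∑ i, h (t i) < 0)) := by
  rw [mu, mem_mourreSet_mvLap_iff, exists_prod_cos_eq_iff]
  refine and_congr_right fun hE1 => ?_
  simp only [sum_commutator_eq hh]
  have hcube : ∀ (a : Fin (n + 1) → ℝ) (j), Real.cos (a j) ^ 2 ∈ Set.Icc (0 : ℝ) 1 := fun a j =>
    ⟨sq_nonneg _, Real.cos_sq_le_one _⟩
  have hto : ∀ P : ℝ → Prop, (∀ a : Fin (n + 1) → ℝ, ∏ j, Real.cos (a j) = E →
      P ((∏ j, Real.cos (a j)) * ∑ j, h (Real.cos (a j) ^ 2))) ↔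
      ∀ t : Fin (n + 1) → ℝ, (∀ i, t i ∈ Set.Icc (0 : ℝ) 1) → ∏ i, t i = E ^ 2 →
        P (E * ∑ i, h (t i)) := by
    intro P
    constructor
    · intro H t ht hp
      obtain ⟨a, ha, hat⟩ := exists_angles ht hp
      have := H a ha
      simpa only [ha, hat] using this
    · intro H a ha
      rw [ha]
      exact H _ (hcube a) (by rw [Finset.prod_pow, ha])
  rw [hto (fun y => 0 < y), hto (fun y => y < 0)]
  -- A negative `E` merely exchanges the two alternatives; at `E = 0` the commutator symbol vanishes
  -- on the whole surface, which contains the origin.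
  rcases lt_trichotomy E 0 with hE | rfl | hE
  · have h1 : ∀ y, 0 < E * y ↔ y < 0 := fun y => smul_pos_iff_of_neg_left hE
    have h2 : ∀ y, E * y < 0 ↔ 0 < y := fun y => smul_neg_iff_of_neg_left hE
    simp only [ne_eq, hE.ne, not_false_eq_true, true_and, h1, h2]
    exact or_comm
  · simp only [zero_mul, lt_irrefl, ne_eq, not_true_eq_false, false_and, iff_false, or_self]
    intro H
    exact H (fun _ => 0) (fun _ => ⟨le_rfl, zero_le_one⟩) (by simp)
  · have h2 : ∀ y, E * y < 0 ↔ y < 0 := fun y => smul_neg_iff_of_pos_left hE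
    simp only [ne_eq, hE.ne', not_false_eq_true, true_and, mul_pos_iff_of_pos_left hE, h2]

end MourreSet

/-! ### The polynomials `h` for κ = 2, 4, 6 -/

section Profiles

/-- The function `h` with `[Δ_j, i A_2] = Δ_j h(Δ_j²)`. -/
def profile₂ (t : ℝ) : ℝ := 2 * (1 - t)

/-- The function `h` with `[Δ_j, i A_4] = Δ_j h(Δ_j²)`. -/
def profile₄ (t : ℝ) : ℝ := 4 * ((1 - t) * (2 * t - 1))

/-- The function `h` with `[Δ_j, i A_6] = Δ_j h(Δ_j²)`. -/
def profile₆ (t : ℝ) : ℝ := 2 * ((1 - t) * (4 * t - 1) * (4 * t - 3))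

lemma sin_mul_sin_profile₂ (a : ℝ) :
    Real.sin ((2 : ℕ) * a) * Real.sin a = Real.cos a * profile₂ (Real.cos a ^ 2) := by
  have h := Real.sin_sq_add_cos_sq a
  rw [profile₂, Nat.cast_ofNat, Real.sin_two_mul]
  linear_combination (2 * Real.cos a) * h

lemma sin_mul_sin_profile₄ (a : ℝ) :
    Real.sin ((4 : ℕ) * a) * Real.sin a = Real.cos a * profile₄ (Real.cos a ^ 2) := by
  have h := Real.sin_sq_add_cos_sq a
  have h4 : ((4 : ℕ) : ℝ) * a = 2 * (2 * a) := by push_cast; ring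
  rw [profile₄, h4, Real.sin_two_mul, Real.sin_two_mul, Real.cos_two_mul]
  linear_combination (4 * Real.cos a * (2 * Real.cos a ^ 2 - 1)) * h

lemma sin_mul_sin_profile₆ (a : ℝ) :
    Real.sin ((6 : ℕ) * a) * Real.sin a = Real.cos a * profile₆ (Real.cos a ^ 2) := by
  have h := Real.sin_sq_add_cos_sq a
  have h6 : ((6 : ℕ) : ℝ) * a = 2 * (3 * a) := by push_cast; ring
  rw [profile₆, h6, Real.sin_two_mul, Real.sin_three_mul, Real.cos_three_mul]
  have hs : Real.sin a ^ 2 = 1 - Real.cos a ^ 2 := by linarith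
  have : 2 * (3 * Real.sin a - 4 * Real.sin a ^ 3) * (4 * Real.cos a ^ 3 - 3 * Real.cos a) *
      Real.sin a = 2 * (Real.sin a ^ 2 * (3 - 4 * Real.sin a ^ 2)) *
        (4 * Real.cos a ^ 3 - 3 * Real.cos a) := by ring
  rw [this, hs]
  ring

end Profiles

/-! ### Polynomial inequalities in two and three variables -/

section Inequalities

variable {x y z : ℝ}

/-- With `s = x + y` and `p = x y` the sum is `4 (-2 s² + 3 s - 2 + 4 p)`. For `s ≥ 1` the bound `p
< 1/4` suffices; for `s < 1` the bound `p ≤ s²/4` does. -/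
lemma profile₄_add_neg (h : x * y < 1 / 4) : profile₄ x + profile₄ y < 0 := by
  have hs : (0 : ℝ) ≤ (x - y) ^ 2 := sq_nonneg _
  simp only [profile₄]
  rcases le_or_gt 1 (x + y) with h1 | h1
  · nlinarith [mul_nonneg (show 0 ≤ x + y - 1 by linarith) (show 0 ≤ 2 * (x + y) - 1 by linarith)]
  · nlinarith [mul_pos (show 0 < 1 - (x + y) by linarith) (show 0 < 2 - (x + y) by linarith)]

lemma profile₄_le (t : ℝ) : profile₄ t ≤ 1 / 2 := by
  simp only [profile₄]
  nlinarith [sq_nonneg (4 * t - 3)]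

lemma profile₄_add_add_neg_of_le (hz0 : 0 ≤ z) (hz : z ≤ 0.43) (hp : x * y * z ≤ 0.08) :
    profile₄ x + profile₄ y + profile₄ z < 0 := by
  -- For `z ≤ 0.3` the value at `z` outweighs twice the maximum 1/2. Otherwise `x y ≤ 0.08 / 0.3`,
  -- and the pair is bounded as in two variables, splitting the sum near `2 √0.267 ≈ 1.033`.
  rcases le_or_gt z 0.3 with h | h
  · have h1 := profile₄_le x
    have h2 := profile₄_le y
    have h3 : profile₄ z < -1 := by
      simp only [profile₄]
      nlinarith
    linarith
  · have h3 : profile₄ z ≤ -0.3 := by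
      simp only [profile₄]
      nlinarith
    have hq : x * y ≤ 0.267 := by
      by_contra! hq
      nlinarith
    have hs : (0 : ℝ) ≤ (x - y) ^ 2 := sq_nonneg _
    have h4 : profile₄ x + profile₄ y ≤ 0.2 := by
      simp only [profile₄]
      rcases le_or_gt 1.033 (x + y) with h1 | h1
      · nlinarith
      · nlinarith
    linarith

lemma profile₄_add_add_neg (hx0 : 0 ≤ x) (hy0 : 0 ≤ y) (hz0 : 0 ≤ z)
    (hp : x * y * z < (√(3 - √3) / 4) ^ 2) : profile₄ x + profile₄ y + profile₄ z < 0 := by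
  have h3 : (1.732 : ℝ) ≤ √3 := Real.le_sqrt_of_sq_le (by norm_num)
  have h3' : √3 ≤ 3 := Real.sqrt_le_iff.2 ⟨by norm_num, by norm_num⟩
  rw [div_pow, Real.sq_sqrt (by linarith)] at hp
  have hp' : x * y * z < 0.07926 := by linarith
  -- `0.43³ > 0.07926`, so some coordinate is at most 0.43.
  by_cases hz : z ≤ 0.43
  · exact profile₄_add_add_neg_of_le hz0 hz (by linarith)
  by_cases hy : y ≤ 0.43
  · have := profile₄_add_add_neg_of_le (x := x) (y := z) hy0 hy (by linarith)
    linarith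
  by_cases hx : x ≤ 0.43
  · have := profile₄_add_add_neg_of_le (x := y) (y := z) hx0 hx (by linarith)
    linarith
  push Not at hx hy hz
  have h1 : 0.43 * 0.43 < x * y := mul_lt_mul'' hx hy (by norm_num) (by norm_num)
  have h2 : 0.43 * 0.43 * 0.43 < x * y * z := mul_lt_mul'' h1 hz (by norm_num) (by norm_num)
  norm_num at h2 hp'
  linarith

/-- For a fixed sum `s` the expression is affine in the product `p`, with slope of the sign of `3 s
- 4`. The extremes thus lie at the ends of the range of `p`: the diagonal `p = s²/4`, the edge `p =
s - 1`, or the prescribed bound on `p`. -/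
lemma profile₆_add_eq (x y : ℝ) : profile₆ x + profile₆ y =
    2 * (-16 * (x + y) ^ 3 + 32 * (x + y) ^ 2 - 19 * (x + y) + 6 -
      16 * (x * y) * (4 - 3 * (x + y))) := by
  simp only [profile₆]
  ring

lemma add_le_one_add_mul (hx : x ≤ 1) (hy : y ≤ 1) : x + y ≤ 1 + x * y := by
  nlinarith [mul_nonneg (sub_nonneg.2 hx) (sub_nonneg.2 hy)]

lemma four_mul_le_add_sq (x y : ℝ) : 4 * (x * y) ≤ (x + y) ^ 2 := by
  nlinarith [sq_nonneg (x - y)]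

lemma profile₆_add_pos (hx0 : 0 ≤ x) (hx : x ≤ 1) (hy0 : 0 ≤ y) (hy : y ≤ 1)
    (hp : x * y < 0.0441) : 0 < profile₆ x + profile₆ y := by
  rw [profile₆_add_eq]
  have h1 := add_le_one_add_mul hx hy
  have h2 := four_mul_le_add_sq x y
  have h0 : 0 ≤ x + y := by linarith
  generalize x + y = s at *
  generalize x * y = p at *
  -- Here `4 - 3 s > 0`, so `p` is replaced by an upper bound: `s²/4` for small `s`, and `0.0441 =
  -- 0.21²` beyond.
  rcases le_or_gt s 0.45 with h | h
  · have h3 : 0 < (1 - s / 2) * ((1 - 2 * s) * (3 - 2 * s)) :=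
      mul_pos (by linarith) (mul_pos (by linarith) (by linarith))
    nlinarith [mul_nonneg (show 0 ≤ s ^ 2 - 4 * p by linarith) (show 0 ≤ 4 - 3 * s by linarith)]
  · have h3 : 0 ≤ (0.0441 - p) * (4 - 3 * s) := mul_nonneg (by linarith) (by linarith)
    have h4 : 0 ≤ (s - 0.45) ^ 2 * (1.05 - s) := mul_nonneg (sq_nonneg _) (by linarith)
    nlinarith [mul_nonneg (show 0 ≤ s - 0.45 by linarith) (show 0 ≤ 1.05 - s by linarith)]

lemma profile₆_add_neg (hx0 : 0 ≤ x) (hx : x ≤ 1) (hy0 : 0 ≤ y) (hy : y ≤ 1)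
    (hp : 0.2809 < x * y) (hp' : x * y < 0.5041) : profile₆ x + profile₆ y < 0 := by
  rw [profile₆_add_eq]
  have h1 := add_le_one_add_mul hx hy
  have h2 := four_mul_le_add_sq x y
  have h0 : 0 ≤ x + y := by linarith
  generalize x + y = s at *
  generalize x * y = p at *
  have hs : 1.06 ≤ s := by nlinarith
  -- For `s ≤ 4/3` a lower bound on `p` is needed: `0.2809 = 0.53²`, then `s - 1`, which takes over
  -- at `s = 1.2809`. Beyond `4/3` an upper bound is needed: `s²/4`, then `0.5041 = 0.71²`.
  rcases le_or_gt s 1.2809 with h | h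
  · have h3 : 0 ≤ (p - 0.2809) * (4 - 3 * s) := mul_nonneg (by linarith) (by linarith)
    nlinarith [mul_nonneg (sq_nonneg (s - 1.237)) h0]
  rcases le_or_gt s (4 / 3) with h4 | h4
  · have h3 : 0 ≤ (p - (s - 1)) * (4 - 3 * s) := mul_nonneg (by linarith) (by linarith)
    have h5 : 0 < (2 - s) * ((4 * s - 5) * (7 - 4 * s)) :=
      mul_pos (by linarith) (mul_pos (by linarith) (by linarith))
    nlinarith
  rcases le_or_gt s 1.45 with h5 | h5
  · have h3 : 0 ≤ (s ^ 2 - 4 * p) * (3 * s - 4) := mul_nonneg (by linarith) (by linarith)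
    have h6 : 0 < (1 - s / 2) * ((2 * s - 1) * (3 - 2 * s)) :=
      mul_pos (by linarith) (mul_pos (by linarith) (by linarith))
    nlinarith
  · have h3 : 0 ≤ (0.5041 - p) * (3 * s - 4) := mul_nonneg (by linarith) (by linarith)
    nlinarith [mul_nonneg (show 0 ≤ s - 1.45 by linarith) (show 0 ≤ s - 1.45 by linarith),
      mul_nonneg (show 0 ≤ s - 1.45 by linarith) (mul_nonneg (show 0 ≤ s - 1.45 by linarith) h0)]

lemma neg_le_profile₆ (hx : x ≤ 1) : -1.07 ≤ profile₆ x := by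
  simp only [profile₆]
  -- The local minimum of `profile₆` is near 0.446; its local maximum, used in the next bound, is
  -- near 0.8872.
  nlinarith [mul_nonneg (sq_nonneg (x - 0.446)) (sub_nonneg.2 hx), sq_nonneg (x - 0.446)]

lemma profile₆_le (hx : 0.3 ≤ x) : profile₆ x ≤ 0.316 := by
  simp only [profile₆]
  nlinarith [mul_nonneg (sq_nonneg (x - 0.8872)) (sub_nonneg.2 hx), sq_nonneg (x - 0.8872)]

lemma profile₆_add_add_pos_of_le (hx0 : 0 ≤ x) (hx : x ≤ 1) (hy0 : 0 ≤ y) (hy : y ≤ 1)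
    (hz0 : 0 ≤ z) (hz : z ≤ 0.186) (hp : x * y * z ≤ 0.0064) :
    0 < profile₆ x + profile₆ y + profile₆ z := by
  -- For `z ≤ 0.1` the value 2.2 beats twice the lower bound -1.07. Otherwise `x y ≤ 0.0064 / 0.1`,
  -- and the pair loses at most 0.5 against a gain of 0.8.
  rcases le_or_gt z 0.1 with h | h
  · have h1 := neg_le_profile₆ hx
    have h2 := neg_le_profile₆ hy
    have h3 : 2.2 ≤ profile₆ z := by
      simp only [profile₆]
      nlinarith [mul_nonneg (sq_nonneg z) (show 0 ≤ 2 - z by linarith)]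
    linarith
  · have hq : x * y ≤ 0.064 := by
      by_contra! hq
      nlinarith
    have h3 : 0.8 ≤ profile₆ z := by
      simp only [profile₆]
      nlinarith [mul_nonneg (sq_nonneg z) (show 0 ≤ 1 - z by linarith), sq_nonneg (z - 0.186)]
    have h4 : -0.5 ≤ profile₆ x + profile₆ y := by
      rw [profile₆_add_eq]
      have h1 := add_le_one_add_mul hx hy
      have h2 := four_mul_le_add_sq x y
      have h0 : 0 ≤ x + y := by linarith
      generalize x + y = s at *
      generalize x * y = p at *
      rcases le_or_gt s 0.5 with h | h
      · have h3 : 0 ≤ (1 - s / 2) * ((1 - 2 * s) * (3 - 2 * s)) :=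
          mul_nonneg (by linarith) (mul_nonneg (by linarith) (by linarith))
        nlinarith [mul_nonneg (show 0 ≤ s ^ 2 - 4 * p by linarith)
          (show 0 ≤ 4 - 3 * s by linarith)]
      · have h3 : 0 ≤ (0.064 - p) * (4 - 3 * s) := mul_nonneg (by linarith) (by linarith)
        have h4 : 0 ≤ (s - 0.5) ^ 2 * (1.07 - s) := mul_nonneg (sq_nonneg _) (by linarith)
        nlinarith [mul_nonneg (show 0 ≤ s - 0.5 by linarith) (show 0 ≤ 1.07 - s by linarith)]
    linarith

lemma profile₆_add_add_pos (hx0 : 0 ≤ x) (hx : x ≤ 1) (hy0 : 0 ≤ y) (hy : y ≤ 1)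
    (hz0 : 0 ≤ z) (hz : z ≤ 1) (hp : x * y * z < 0.0064) :
    0 < profile₆ x + profile₆ y + profile₆ z := by
  -- `0.186³ > 0.0064`, so some coordinate is at most 0.186.
  by_cases hz' : z ≤ 0.186
  · exact profile₆_add_add_pos_of_le hx0 hx hy0 hy hz0 hz' hp.le
  by_cases hy' : y ≤ 0.186
  · have := profile₆_add_add_pos_of_le hx0 hx hz0 hz hy0 hy' (by linarith)
    linarith
  by_cases hx' : x ≤ 0.186
  · have := profile₆_add_add_pos_of_le hy0 hy hz0 hz hx0 hx' (by linarith)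
    linarith
  push Not at hx' hy' hz'
  have h1 : 0.186 * 0.186 < x * y := mul_lt_mul'' hx' hy' (by norm_num) (by norm_num)
  have h2 : 0.186 * 0.186 * 0.186 < x * y * z :=
    mul_lt_mul'' h1 hz' (by norm_num) (by norm_num)
  norm_num at h2 hp
  linarith

lemma profile₆_le_of_mem (hx : 0.3249 ≤ x) (hx' : x ≤ 0.598) : profile₆ x ≤ -0.67 := by
  simp only [profile₆]
  nlinarith [mul_nonneg (sub_nonneg.2 hx) (sub_nonneg.2 hx'),
    mul_nonneg (mul_nonneg (sub_nonneg.2 hx) (sub_nonneg.2 hx')) (show 0 ≤ x by linarith),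
    mul_nonneg (mul_nonneg (sub_nonneg.2 hx) (sub_nonneg.2 hx')) (show 0 ≤ 1 - x by linarith)]

lemma profile₆_add_add_neg_of_le (hx0 : 0 ≤ x) (hy0 : 0 ≤ y) (hx : x ≤ 1) (hy : y ≤ 1)
    (hz0 : 0 ≤ z) (hz : z ≤ 0.6956) (hp : 0.3249 < x * y * z) (hp' : x * y * z < 0.3364) :
    profile₆ x + profile₆ y + profile₆ z < 0 := by
  have hxy : x * y ≤ 1 := mul_le_one₀ hx hy0 hy
  -- Every coordinate exceeds 0.3249, the other two being at most 1. For `z ≤ 0.598` the value -0.67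
  -- beats `2 · 0.316`; otherwise `x y` lies between `0.3249 / 0.6956` and `0.3364 / 0.598`, which
  -- bounds the pair by 0.2.
  rcases le_or_gt z 0.598 with h | h
  · have h1 := profile₆_le (x := x) (by nlinarith [mul_le_one₀ hy hz0 (show z ≤ 1 by linarith)])
    have h2 := profile₆_le (x := y) (by nlinarith [mul_le_one₀ hx hz0 (show z ≤ 1 by linarith)])
    have h3 := profile₆_le_of_mem (x := z) (by nlinarith) h
    linarith
  · have h3 : profile₆ z ≤ -0.23 := by
      simp only [profile₆]
      nlinarith [mul_nonneg (show 0 ≤ z - 0.598 by linarith) (show 0 ≤ 0.6956 - z by linarith),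
        mul_nonneg (mul_nonneg (show 0 ≤ z - 0.598 by linarith)
          (show 0 ≤ 0.6956 - z by linarith)) hz0]
    have hq : x * y ≤ 0.563 := by
      by_contra! hq
      nlinarith
    have hq' : 0.467 ≤ x * y := by
      by_contra! hq'
      nlinarith
    have h4 : profile₆ x + profile₆ y ≤ 0.2 := by
      rw [profile₆_add_eq]
      have h2 := four_mul_le_add_sq x y
      have h0 : 0 ≤ x + y := by linarith
      generalize x + y = s at *
      generalize x * y = p at *
      have hs : 4 / 3 ≤ s := by nlinarith
      have h3 : 0 ≤ (0.563 - p) * (3 * s - 4) := mul_nonneg (by linarith) (by linarith)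
      nlinarith [mul_nonneg (sq_nonneg (s - 1.448)) h0, sq_nonneg (s - 1.448)]
    linarith

lemma profile₆_add_add_neg (hx0 : 0 ≤ x) (hx : x ≤ 1) (hy0 : 0 ≤ y) (hy : y ≤ 1)
    (hz0 : 0 ≤ z) (hz : z ≤ 1) (hp : 0.3249 < x * y * z) (hp' : x * y * z < 0.3364) :
    profile₆ x + profile₆ y + profile₆ z < 0 := by
  -- `0.6956³ > 0.3364`, so some coordinate is at most 0.6956.
  by_cases hz' : z ≤ 0.6956
  · exact profile₆_add_add_neg_of_le hx0 hy0 hx hy hz0 hz' hp hp'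
  by_cases hy' : y ≤ 0.6956
  · have := profile₆_add_add_neg_of_le hx0 hz0 hx hz hy0 hy' (by linarith) (by linarith)
    linarith
  by_cases hx' : x ≤ 0.6956
  · have := profile₆_add_add_neg_of_le hy0 hz0 hy hz hx0 hx' (by linarith) (by linarith)
    linarith
  push Not at hx' hy' hz'
  have h1 : 0.6956 * 0.6956 < x * y := mul_lt_mul'' hx' hy' (by norm_num) (by norm_num)
  have h2 : 0.6956 * 0.6956 * 0.6956 < x * y * z :=
    mul_lt_mul'' h1 hz' (by norm_num) (by norm_num)
  norm_num at h2 hp'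
  linarith

end Inequalities

/-! ### General criteria for membership and exclusion -/

section Membership

variable {n κ : ℕ} {h : ℝ → ℝ} {E : ℝ}

/-- `h` is the function with `[Δ_j, i A_κ] = Δ_j h(Δ_j²)`. -/
def IsProfile (κ : ℕ) (h : ℝ → ℝ) : Prop :=
  ∀ a : ℝ, Real.sin (κ * a) * Real.sin a = Real.cos a * h (Real.cos a ^ 2)

lemma IsProfile.neg_mem_mu_iff (hh : IsProfile κ h) : -E ∈ mu (n + 1) κ ↔ E ∈ mu (n + 1) κ := by
  rw [mem_mu_iff hh, mem_mu_iff hh, abs_neg, neg_sq, neg_ne_zero]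

lemma IsProfile.abs_mem_mu_iff (hh : IsProfile κ h) : |E| ∈ mu (n + 1) κ ↔ E ∈ mu (n + 1) κ := by
  rcases abs_choice E with h1 | h1
  · rw [h1]
  · rw [h1, hh.neg_mem_mu_iff]

lemma IsProfile.abs_le_one (hh : IsProfile κ h) (hE : E ∈ mu (n + 1) κ) : |E| ≤ 1 :=
  ((mem_mu_iff hh E).1 hE).1

lemma IsProfile.zero_notMem_mu (hh : IsProfile κ h) : (0 : ℝ) ∉ mu (n + 1) κ := fun hE =>
  ((mem_mu_iff hh 0).1 hE).2.1 rfl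

lemma IsProfile.mem_mu_of_pos (hh : IsProfile κ h) (hE : E ∈ Set.Ioo (0 : ℝ) 1)
    (H : ∀ t : Fin (n + 1) → ℝ, (∀ i, t i ∈ Set.Icc (0 : ℝ) 1) → ∏ i, t i = E ^ 2 →
      0 < ∑ i, h (t i)) : E ∈ mu (n + 1) κ ∩ Set.Icc 0 1 :=
  ⟨(mem_mu_iff hh E).2 ⟨by rw [abs_of_pos hE.1]; exact hE.2.le, hE.1.ne', Or.inl H⟩,
    hE.1.le, hE.2.le⟩

lemma IsProfile.mem_mu_of_neg (hh : IsProfile κ h) (hE : E ∈ Set.Ioo (0 : ℝ) 1)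
    (H : ∀ t : Fin (n + 1) → ℝ, (∀ i, t i ∈ Set.Icc (0 : ℝ) 1) → ∏ i, t i = E ^ 2 →
      ∑ i, h (t i) < 0) : E ∈ mu (n + 1) κ ∩ Set.Icc 0 1 :=
  ⟨(mem_mu_iff hh E).2 ⟨by rw [abs_of_pos hE.1]; exact hE.2.le, hE.1.ne', Or.inr H⟩,
    hE.1.le, hE.2.le⟩

lemma IsProfile.mem_mu_one (hh : IsProfile κ h) (hE : E ∈ Set.Ioo (0 : ℝ) 1)
    (H : h (E ^ 2) ≠ 0) : E ∈ mu 1 κ ∩ Set.Icc 0 1 := by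
  rcases H.lt_or_gt with H | H
  · refine hh.mem_mu_of_neg (n := 0) hE fun t _ hp => ?_
    rw [Fin.prod_univ_one] at hp
    rwa [Fin.sum_univ_one, hp]
  · refine hh.mem_mu_of_pos (n := 0) hE fun t _ hp => ?_
    rw [Fin.prod_univ_one] at hp
    rwa [Fin.sum_univ_one, hp]

/-- The energies above which `h` is positive. -/
lemma IsProfile.mem_mu_of_forall_pos (hh : IsProfile κ h) (hE : E ∈ Set.Ioo (0 : ℝ) 1)
    (h1 : h 1 = 0) (H : ∀ t, E ^ 2 ≤ t → t < 1 → 0 < h t) :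
    E ∈ mu (n + 1) κ ∩ Set.Icc 0 1 := by
  refine hh.mem_mu_of_pos hE fun t ht hp => ?_
  have hle : ∀ i, E ^ 2 ≤ t i := by
    intro i
    rw [← hp, ← Finset.mul_prod_erase _ _ (Finset.mem_univ i)]
    exact mul_le_of_le_one_right (ht i).1
      (Finset.prod_le_one (fun j _ => (ht j).1) fun j _ => (ht j).2)
  refine Finset.sum_pos' (fun i _ => ?_) ?_
  · rcases (ht i).2.lt_or_eq with h2 | h2
    · exact (H _ (hle i) h2).le
    · rw [h2, h1]
  -- A vanishing sum would put every coordinate at 1, against `∏ t_i = E² < 1`.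
  · by_contra! hcon
    have hall : ∀ i, t i = 1 := by
      intro i
      by_contra hne
      have h2 := H _ (hle i) (lt_of_le_of_ne (ht i).2 hne)
      exact (hcon i (Finset.mem_univ i)).not_gt h2
    simp only [hall, Finset.prod_const_one] at hp
    have : E ^ 2 < 1 := pow_lt_one₀ hE.1.le hE.2 two_ne_zero
    linarith

lemma IsProfile.notMem_mu_of_sum_eq_zero (hh : IsProfile κ h) {t : Fin (n + 1) → ℝ}
    (ht : ∀ i, t i ∈ Set.Icc (0 : ℝ) 1) (hp : ∏ i, t i = E ^ 2) (h0 : ∑ i, h (t i) = 0) :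
    E ∉ mu (n + 1) κ := by
  intro hE
  rcases ((mem_mu_iff hh E).1 hE).2.2 with H | H
  · exact (H t ht hp).ne' h0
  · exact (H t ht hp).ne h0

/-- If `h` does not have the same strict sign at `(r, …, r)` and at `(E², 1, …, 1)`, two points of
the energy surface, then it vanishes at a point in between. -/
lemma IsProfile.notMem_mu_of_pow_eq (hh : IsProfile κ h) (hc : Continuous h) (h1 : h 1 = 0) {r : ℝ}
    (hr0 : 0 < r) (hr1 : r ≤ 1) (hrE : r ^ (n + 1) = E ^ 2) (hs : h r * h (E ^ 2) ≤ 0) :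
    E ∉ mu (n + 1) κ := by
  let F : ℝ → ℝ := fun s => h (E ^ 2 / s ^ n) + n * h s
  have hF : ContinuousOn F (Set.Icc r 1) := by
    refine ContinuousOn.add (hc.comp_continuousOn (continuousOn_const.div (by fun_prop) ?_))
      (by fun_prop)
    intro s hs
    exact (pow_pos (hr0.trans_le hs.1) n).ne'
  have hFr : F r = (n + 1) * h r := by
    have : E ^ 2 / r ^ n = r := by
      rw [← hrE, pow_succ, mul_div_cancel_left₀ _ (pow_pos hr0 n).ne']
    simp only [F, this]
    ring
  have hF1 : F 1 = h (E ^ 2) := by simp [F, h1]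
  have hzero : ∃ s ∈ Set.Icc r 1, F s = 0 := by
    have hmul : F r * F 1 ≤ 0 := by
      rw [hFr, hF1, mul_assoc]
      exact mul_nonpos_of_nonneg_of_nonpos (by positivity) hs
    rcases mul_nonpos_iff.1 hmul with ⟨ha, hb⟩ | ⟨ha, hb⟩
    · exact intermediate_value_Icc' hr1 hF ⟨hb, ha⟩
    · exact intermediate_value_Icc hr1 hF ⟨ha, hb⟩
  obtain ⟨s, ⟨hrs, hs1⟩, hFs⟩ := hzero
  have hs0 : 0 < s := hr0.trans_le hrs
  refine hh.notMem_mu_of_sum_eq_zero (t := Fin.cons (E ^ 2 / s ^ n) fun _ => s) (fun i => ?_) ?_ ?_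
  · refine Fin.cases ?_ (fun _ => ?_) i
    · rw [Fin.cons_zero]
      refine ⟨by positivity, (div_le_one (pow_pos hs0 n)).2 ?_⟩
      rw [← hrE]
      exact (pow_le_pow_of_le_one hr0.le hr1 n.le_succ).trans (pow_le_pow_left₀ hr0.le hrs n)
    · rw [Fin.cons_succ]
      exact ⟨hs0.le, hs1⟩
  · rw [Fin.prod_univ_succ]
    simp only [Fin.cons_zero, Fin.cons_succ, Finset.prod_const, Finset.card_univ, Fintype.card_fin]
    exact div_mul_cancel₀ _ (pow_pos hs0 n).ne'
  · rw [Fin.sum_univ_succ]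
    simp only [Fin.cons_zero, Fin.cons_succ, Finset.sum_const, Finset.card_univ, Fintype.card_fin,
      nsmul_eq_mul]
    exact hFs

/-- The bounds on `E²` locate its `(n + 1)`-th root in `[a, b]`, so that the sign condition can be
read off an interval without computing the root. -/
lemma IsProfile.mem_diff_mu (hh : IsProfile κ h) (hc : Continuous h) (h1 : h 1 = 0) {a b : ℝ}
    (hE0 : 0 ≤ E) (ha0 : 0 < a) (hb1 : b ≤ 1) (ha : a ^ (n + 1) ≤ E ^ 2)
    (hb : E ^ 2 ≤ b ^ (n + 1)) (hb0 : 0 ≤ b)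
    (hs : ∀ r, a ≤ r → r ≤ b → h r * h (E ^ 2) ≤ 0) :
    E ∈ Set.Icc 0 1 \ mu (n + 1) κ := by
  have hE : 0 ≤ E ^ 2 := sq_nonneg E
  set r : ℝ := (E ^ 2) ^ (((n + 1 : ℕ) : ℝ)⁻¹) with hr
  have hr0 : 0 ≤ r := Real.rpow_nonneg hE _
  have hrE : r ^ (n + 1) = E ^ 2 := Real.rpow_inv_natCast_pow hE n.succ_ne_zero
  have har : a ≤ r := (pow_le_pow_iff_left₀ ha0.le hr0 n.succ_ne_zero).1 (hrE ▸ ha)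
  have hrb : r ≤ b := (pow_le_pow_iff_left₀ hr0 hb0 n.succ_ne_zero).1 (hrE ▸ hb)
  refine ⟨⟨hE0, ?_⟩, hh.notMem_mu_of_pow_eq hc h1 (ha0.trans_le har) (hrb.trans hb1) hrE
    (hs r har hrb)⟩
  refine (pow_le_one_iff_of_nonneg hE0 two_ne_zero).1 (hb.trans (pow_le_one₀ hb0 hb1))

lemma IsProfile.mem_diff_mu_one (hh : IsProfile κ h) (hc : Continuous h) (h1 : h 1 = 0)
    (hE : 0 < E) (hE1 : E ≤ 1) (h0 : h (E ^ 2) = 0) : E ∈ Set.Icc 0 1 \ mu 1 κ :=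
  hh.mem_diff_mu (n := 0) (a := E ^ 2) (b := E ^ 2) hc h1 hE.le (by positivity)
    (pow_le_one₀ hE.le hE1) (by simp) (by simp) (by positivity) (by simp [h0])

lemma IsProfile.pair_subset_diff_mu (hh : IsProfile κ h) (hc : Continuous h) (h1 : h 1 = 0) :
    ({0, 1} : Set ℝ) ⊆ Set.Icc 0 1 \ mu (n + 1) κ := by
  rintro E (rfl | rfl)
  · exact ⟨⟨le_rfl, zero_le_one⟩, hh.zero_notMem_mu⟩
  · exact hh.mem_diff_mu (a := 1) (b := 1) hc h1 zero_le_one one_pos le_rfl (by simp) (by simp)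
      zero_le_one (by simp [h1])

/-- The Mourre set is determined by its positive part. -/
lemma IsProfile.mu_eq (hh : IsProfile κ h) {S T : Set ℝ} (hS : S ⊆ mu (n + 1) κ ∩ Set.Icc 0 1)
    (hT : T ⊆ Set.Icc 0 1 \ mu (n + 1) κ) (hST : Set.Icc 0 1 ⊆ S ∪ T) :
    mu (n + 1) κ = {E | |E| ∈ S} := by
  ext E
  rw [← hh.abs_mem_mu_iff]
  refine ⟨fun hE => ?_, fun hE => (hS hE).1⟩
  have hE1 := hh.abs_le_one hE
  rw [abs_abs] at hE1
  rcases hST ⟨abs_nonneg E, hE1⟩ with h2 | h2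
  · exact h2
  · exact absurd hE (hT h2).2

end Membership

/-! ### The energy bands and the excluded intervals -/

section Bands

lemma isProfile₂ : IsProfile 2 profile₂ := sin_mul_sin_profile₂
lemma isProfile₄ : IsProfile 4 profile₄ := sin_mul_sin_profile₄
lemma isProfile₆ : IsProfile 6 profile₆ := sin_mul_sin_profile₆

lemma continuous_profile₂ : Continuous profile₂ := by unfold profile₂; fun_prop
lemma continuous_profile₄ : Continuous profile₄ := by unfold profile₄; fun_prop
lemma continuous_profile₆ : Continuous profile₆ := by unfold profile₆; fun_prop

lemma profile₂_one : profile₂ 1 = 0 := by norm_num [profile₂]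
lemma profile₄_one : profile₄ 1 = 0 := by norm_num [profile₄]
lemma profile₆_one : profile₆ 1 = 0 := by norm_num [profile₆]

lemma one_div_sqrt_two_sq : (1 / √2) ^ 2 = (1 / 2 : ℝ) := by
  rw [div_pow, Real.sq_sqrt (by norm_num)]; norm_num

lemma sqrt_three_div_two_sq : (√3 / 2) ^ 2 = (3 / 4 : ℝ) := by
  rw [div_pow, Real.sq_sqrt (by norm_num)]; norm_num

lemma one_div_two_mul_sqrt_two_sq : (1 / (2 * √2)) ^ 2 = (1 / 8 : ℝ) := by
  rw [div_pow, mul_pow, Real.sq_sqrt (by norm_num)]; norm_num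

lemma three_mul_sqrt_three_div_eight_sq : (3 * √3 / 8) ^ 2 = (27 / 64 : ℝ) := by
  rw [div_pow, mul_pow, Real.sq_sqrt (by norm_num)]; norm_num

variable {n : ℕ} {E : ℝ}

lemma Ioo_subset_mu_two : Set.Ioo 0 1 ⊆ mu (n + 1) 2 ∩ Set.Icc 0 1 := fun _ hE =>
  isProfile₂.mem_mu_of_forall_pos hE profile₂_one fun t _ ht => by
    rw [profile₂]; linarith

lemma mem_mu_four_of_lt (hE : E ∈ Set.Ioo (1 / √2) 1) : E ∈ mu (n + 1) 4 ∩ Set.Icc 0 1 := by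
  have h0 : 0 < 1 / √2 := by positivity
  have hsq : (1 / √2) ^ 2 < E ^ 2 := pow_lt_pow_left₀ hE.1 h0.le two_ne_zero
  rw [one_div_sqrt_two_sq] at hsq
  refine isProfile₄.mem_mu_of_forall_pos ⟨h0.trans hE.1, hE.2⟩ profile₄_one fun t h1 h2 => ?_
  exact mul_pos (by norm_num) (mul_pos (by linarith) (by linarith))

lemma mem_mu_six_of_lt (hE : E ∈ Set.Ioo (√3 / 2) 1) : E ∈ mu (n + 1) 6 ∩ Set.Icc 0 1 := by
  have h0 : 0 < √3 / 2 := by positivity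
  have hsq : (√3 / 2) ^ 2 < E ^ 2 := pow_lt_pow_left₀ hE.1 h0.le two_ne_zero
  rw [sqrt_three_div_two_sq] at hsq
  refine isProfile₆.mem_mu_of_forall_pos ⟨h0.trans hE.1, hE.2⟩ profile₆_one fun t h1 h2 => ?_
  exact mul_pos (by norm_num) (mul_pos (mul_pos (by linarith) (by linarith)) (by linarith))

lemma bands_one_four : Set.Ioo 0 1 \ {1 / √2} ⊆ mu 1 4 ∩ Set.Icc 0 1 := by
  rintro E ⟨hE, hne⟩
  refine isProfile₄.mem_mu_one hE fun h0 => hne ?_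
  have hE2 : E ^ 2 < 1 := pow_lt_one₀ hE.1.le hE.2 two_ne_zero
  have h1 : E ^ 2 = (1 / √2) ^ 2 := by
    rw [one_div_sqrt_two_sq]
    rw [profile₄] at h0
    have h2 : 2 * E ^ 2 - 1 = 0 :=
      (mul_eq_zero.1 (mul_eq_zero.1 h0 |>.resolve_left (by norm_num))).resolve_left (by linarith)
    linarith
  exact (pow_left_inj₀ hE.1.le (by positivity) two_ne_zero).1 h1

lemma bands_one_six : Set.Ioo 0 1 \ {1 / 2, √3 / 2} ⊆ mu 1 6 ∩ Set.Icc 0 1 := by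
  rintro E ⟨hE, hne⟩
  refine isProfile₆.mem_mu_one hE fun h0 => hne ?_
  have hE2 : E ^ 2 < 1 := pow_lt_one₀ hE.1.le hE.2 two_ne_zero
  rw [profile₆] at h0
  rcases mul_eq_zero.1 (mul_eq_zero.1 h0 |>.resolve_left (by norm_num)) with h1 | h1
  · have h2 := (mul_eq_zero.1 h1).resolve_left (by linarith)
    left
    exact (pow_left_inj₀ hE.1.le (by positivity) two_ne_zero).1 (by linarith)
  · right
    refine (pow_left_inj₀ hE.1.le (by positivity) two_ne_zero).1 ?_
    rw [sqrt_three_div_two_sq]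
    linarith

lemma bands_two_four :
    Set.Ioo 0 (1 / 2) ∪ Set.Ioo (1 / √2) 1 ⊆ mu 2 4 ∩ Set.Icc 0 1 := by
  rintro E (hE | hE)
  · refine isProfile₄.mem_mu_of_neg (n := 1) ⟨hE.1, by linarith [hE.2]⟩ fun t ht hp => ?_
    rw [Fin.prod_univ_two] at hp
    rw [Fin.sum_univ_two]
    refine profile₄_add_neg ?_
    rw [hp]
    exact (pow_lt_pow_left₀ hE.2 hE.1.le two_ne_zero).trans_eq (by norm_num)
  · exact mem_mu_four_of_lt hE

lemma bands_three_four :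
    Set.Ioo 0 (√(3 - √3) / 4) ∪ Set.Ioo (1 / √2) 1 ⊆ mu 3 4 ∩ Set.Icc 0 1 := by
  rintro E (hE | hE)
  · have h3 : √(3 - √3) ≤ 2 := Real.sqrt_le_iff.2 ⟨by norm_num, by linarith [Real.sqrt_nonneg 3]⟩
    refine isProfile₄.mem_mu_of_neg (n := 2) ⟨hE.1, by linarith [hE.2]⟩ fun t ht hp => ?_
    rw [Fin.prod_univ_three] at hp
    rw [Fin.sum_univ_three]
    refine profile₄_add_add_neg (ht 0).1 (ht 1).1 (ht 2).1 ?_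
    rw [hp]
    exact pow_lt_pow_left₀ hE.2 hE.1.le two_ne_zero
  · exact mem_mu_four_of_lt hE

lemma bands_two_six :
    Set.Ioo 0 0.21 ∪ Set.Ioo 0.53 0.71 ∪ Set.Ioo (√3 / 2) 1 ⊆ mu 2 6 ∩ Set.Icc 0 1 := by
  rintro E ((⟨h0, h1⟩ | ⟨h0, h1⟩) | hE)
  · refine isProfile₆.mem_mu_of_pos (n := 1) ⟨h0, by linarith⟩ fun t ht hp => ?_
    rw [Fin.prod_univ_two] at hp
    rw [Fin.sum_univ_two]
    refine profile₆_add_pos (ht 0).1 (ht 0).2 (ht 1).1 (ht 1).2 ?_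
    rw [hp]
    nlinarith
  · have h2 : 0 < E := lt_trans (by norm_num) h0
    refine isProfile₆.mem_mu_of_neg (n := 1) ⟨h2, by linarith⟩ fun t ht hp => ?_
    rw [Fin.prod_univ_two] at hp
    rw [Fin.sum_univ_two]
    refine profile₆_add_neg (ht 0).1 (ht 0).2 (ht 1).1 (ht 1).2 ?_ ?_ <;> rw [hp] <;> nlinarith
  · exact mem_mu_six_of_lt hE

lemma bands_three_six :
    Set.Ioo 0 0.08 ∪ Set.Ioo 0.57 0.58 ∪ Set.Ioo (√3 / 2) 1 ⊆ mu 3 6 ∩ Set.Icc 0 1 := by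
  rintro E ((⟨h0, h1⟩ | ⟨h0, h1⟩) | hE)
  · refine isProfile₆.mem_mu_of_pos (n := 2) ⟨h0, by linarith⟩ fun t ht hp => ?_
    rw [Fin.prod_univ_three] at hp
    rw [Fin.sum_univ_three]
    refine profile₆_add_add_pos (ht 0).1 (ht 0).2 (ht 1).1 (ht 1).2 (ht 2).1 (ht 2).2 ?_
    rw [hp]
    nlinarith
  · have h2 : 0 < E := lt_trans (by norm_num) h0
    refine isProfile₆.mem_mu_of_neg (n := 2) ⟨h2, by linarith⟩ fun t ht hp => ?_
    rw [Fin.prod_univ_three] at hp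
    rw [Fin.sum_univ_three]
    refine profile₆_add_add_neg (ht 0).1 (ht 0).2 (ht 1).1 (ht 1).2 (ht 2).1 (ht 2).2 ?_ ?_ <;>
      rw [hp] <;> nlinarith
  · exact mem_mu_six_of_lt hE

lemma excluded_one_four : {0, 1 / √2, 1} ⊆ Set.Icc 0 1 \ mu 1 4 := by
  have hp := isProfile₄.pair_subset_diff_mu (n := 0) continuous_profile₄ profile₄_one
  rintro E (rfl | rfl | rfl)
  · exact hp (Or.inl rfl)
  · have h1 : 1 / √2 ≤ (1 : ℝ) := by
      refine (pow_le_one_iff_of_nonneg (by positivity) two_ne_zero).1 ?_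
      rw [one_div_sqrt_two_sq]; norm_num
    refine isProfile₄.mem_diff_mu_one continuous_profile₄ profile₄_one (by positivity) h1 ?_
    rw [one_div_sqrt_two_sq]
    norm_num [profile₄]
  · exact hp (Or.inr rfl)

lemma excluded_one_six : {0, 1 / 2, √3 / 2, 1} ⊆ Set.Icc 0 1 \ mu 1 6 := by
  have hp := isProfile₆.pair_subset_diff_mu (n := 0) continuous_profile₆ profile₆_one
  rintro E (rfl | rfl | rfl | rfl)
  · exact hp (Or.inl rfl)
  · refine isProfile₆.mem_diff_mu_one continuous_profile₆ profile₆_one (by norm_num)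
      (by norm_num) ?_
    norm_num [profile₆]
  · have h1 : √3 / 2 ≤ (1 : ℝ) := by
      refine (pow_le_one_iff_of_nonneg (by positivity) two_ne_zero).1 ?_
      rw [sqrt_three_div_two_sq]; norm_num
    refine isProfile₆.mem_diff_mu_one continuous_profile₆ profile₆_one (by positivity) h1 ?_
    rw [sqrt_three_div_two_sq]
    norm_num [profile₆]
  · exact hp (Or.inr rfl)

/-- `profile₄` is nonnegative on `[1/2, 1]`, where the root of `E²` lies, and nonpositive at `E² ≤
1/2`. -/
lemma mem_diff_mu_four (hE : 0 ≤ E) (h1 : (1 / 2) ^ (n + 1) ≤ E ^ 2) (h2 : E ^ 2 ≤ 1 / 2) :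
    E ∈ Set.Icc 0 1 \ mu (n + 1) 4 := by
  refine isProfile₄.mem_diff_mu (a := 1 / 2) (b := 1) continuous_profile₄ profile₄_one hE
    (by norm_num) le_rfl h1 (by rw [one_pow]; linarith) zero_le_one fun r hr hr1 => ?_
  refine mul_nonpos_of_nonneg_of_nonpos ?_ ?_
  · exact mul_nonneg (by norm_num) (mul_nonneg (by linarith) (by linarith))
  · exact mul_nonpos_of_nonneg_of_nonpos (by norm_num)
      (mul_nonpos_of_nonneg_of_nonpos (by linarith) (by linarith))

/-- The root of `E²` lies in `[1/4, 3/4]`, where `profile₆` is nonpositive, while `E² ≤ 1/4` makes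
it nonnegative. The companion lemma below uses the next pair of sign intervals, `[3/4, 1]` and
`[1/4, 3/4]`. -/
lemma mem_diff_mu_six_of_le (hE : 0 ≤ E) (h1 : (1 / 4) ^ (n + 1) ≤ E ^ 2)
    (h2 : E ^ 2 ≤ (3 / 4) ^ (n + 1)) (h3 : E ^ 2 ≤ 1 / 4) :
    E ∈ Set.Icc 0 1 \ mu (n + 1) 6 := by
  refine isProfile₆.mem_diff_mu (a := 1 / 4) (b := 3 / 4) continuous_profile₆ profile₆_one hE
    (by norm_num) (by norm_num) h1 h2 (by norm_num) fun r hr hr1 => ?_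
  refine mul_nonpos_of_nonpos_of_nonneg ?_ ?_
  · exact mul_nonpos_of_nonneg_of_nonpos (by norm_num)
      (mul_nonpos_of_nonneg_of_nonpos (mul_nonneg (by linarith) (by linarith)) (by linarith))
  · exact mul_nonneg (by norm_num) (mul_nonneg_of_nonpos_of_nonpos
      (mul_nonpos_of_nonneg_of_nonpos (by linarith) (by linarith)) (by linarith))

lemma mem_diff_mu_six_of_ge (hE : 0 ≤ E) (h1 : (3 / 4) ^ (n + 1) ≤ E ^ 2) (h2 : 1 / 4 ≤ E ^ 2)
    (h3 : E ^ 2 ≤ 3 / 4) : E ∈ Set.Icc 0 1 \ mu (n + 1) 6 := by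
  refine isProfile₆.mem_diff_mu (a := 3 / 4) (b := 1) continuous_profile₆ profile₆_one hE
    (by norm_num) le_rfl h1 (by rw [one_pow]; linarith) zero_le_one fun r hr hr1 => ?_
  refine mul_nonpos_of_nonneg_of_nonpos ?_ ?_
  · exact mul_nonneg (by norm_num)
      (mul_nonneg (mul_nonneg (by linarith) (by linarith)) (by linarith))
  · exact mul_nonpos_of_nonneg_of_nonpos (by norm_num)
      (mul_nonpos_of_nonneg_of_nonpos (mul_nonneg (by linarith) (by linarith)) (by linarith))

lemma sq_mem_Icc {a b : ℝ} (ha : 0 ≤ a) (hE : E ∈ Set.Icc a b) :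
    0 ≤ E ∧ a ^ 2 ≤ E ^ 2 ∧ E ^ 2 ≤ b ^ 2 :=
  ⟨ha.trans hE.1, pow_le_pow_left₀ ha hE.1 2, pow_le_pow_left₀ (ha.trans hE.1) hE.2 2⟩

lemma excluded_two_four :
    Set.Icc (1 / 2) (1 / √2) ∪ {0, 1} ⊆ Set.Icc 0 1 \ mu 2 4 := by
  rintro E (hE | hE)
  · obtain ⟨h0, h1, h2⟩ := sq_mem_Icc (by norm_num) hE
    rw [one_div_sqrt_two_sq] at h2
    exact mem_diff_mu_four (n := 1) h0 h1 h2
  · exact isProfile₄.pair_subset_diff_mu (n := 1) continuous_profile₄ profile₄_one hE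

lemma excluded_three_four :
    Set.Icc (1 / (2 * √2)) (1 / √2) ∪ {0, 1} ⊆ Set.Icc 0 1 \ mu 3 4 := by
  rintro E (hE | hE)
  · obtain ⟨h0, h1, h2⟩ := sq_mem_Icc (by positivity) hE
    rw [one_div_two_mul_sqrt_two_sq] at h1
    rw [one_div_sqrt_two_sq] at h2
    exact mem_diff_mu_four (n := 2) h0 (by norm_num at h1 ⊢; exact h1) h2
  · exact isProfile₄.pair_subset_diff_mu (n := 2) continuous_profile₄ profile₄_one hE

lemma excluded_two_six :
    Set.Icc (1 / 4) (1 / 2) ∪ Set.Icc (3 / 4) (√3 / 2) ∪ {0, 1} ⊆ Set.Icc 0 1 \ mu 2 6 := by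
  rintro E ((hE | hE) | hE)
  · obtain ⟨h0, h1, h2⟩ := sq_mem_Icc (by norm_num) hE
    norm_num at h2
    exact mem_diff_mu_six_of_le (n := 1) h0 h1 (h2.trans (by norm_num)) h2
  · obtain ⟨h0, h1, h2⟩ := sq_mem_Icc (by norm_num) hE
    rw [sqrt_three_div_two_sq] at h2
    exact mem_diff_mu_six_of_ge (n := 1) h0 h1 (le_trans (by norm_num) h1) h2
  · exact isProfile₆.pair_subset_diff_mu (n := 1) continuous_profile₆ profile₆_one hE

lemma excluded_three_six :
    Set.Icc (1 / 8) (1 / 2) ∪ Set.Icc (3 * √3 / 8) (√3 / 2) ∪ {0, 1} ⊆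
      Set.Icc 0 1 \ mu 3 6 := by
  rintro E ((hE | hE) | hE)
  · obtain ⟨h0, h1, h2⟩ := sq_mem_Icc (by norm_num) hE
    norm_num at h2
    exact mem_diff_mu_six_of_le (n := 2) h0 (le_trans (by norm_num) h1) (h2.trans (by norm_num)) h2
  · obtain ⟨h0, h1, h2⟩ := sq_mem_Icc (by positivity) hE
    rw [three_mul_sqrt_three_div_eight_sq] at h1
    rw [sqrt_three_div_two_sq] at h2
    exact mem_diff_mu_six_of_ge (n := 2) h0 (le_trans (by norm_num) h1)
      (le_trans (by norm_num) h1) h2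
  · exact isProfile₆.pair_subset_diff_mu (n := 2) continuous_profile₆ profile₆_one hE

lemma mu_two_eq : mu (n + 1) 2 = Set.Ioo (-1) 0 ∪ Set.Ioo 0 1 := by
  rw [isProfile₂.mu_eq Ioo_subset_mu_two
    (isProfile₂.pair_subset_diff_mu continuous_profile₂ profile₂_one)]
  · ext E
    simp only [Set.mem_ofPred_eq, Set.mem_Ioo, abs_pos, abs_lt, Set.mem_union]
    grind
  · rintro E ⟨h0, h1⟩
    simp only [Set.mem_union, Set.mem_Ioo, Set.mem_insert_iff, Set.mem_singleton_iff]
    grind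

lemma mu_one_four_eq : mu 1 4 = {E | |E| ∈ Set.Ioo 0 1 \ {1 / √2}} := by
  refine isProfile₄.mu_eq (n := 0) bands_one_four excluded_one_four ?_
  rintro E ⟨h0, h1⟩
  simp only [Set.mem_union, Set.mem_sdiff, Set.mem_Ioo, Set.mem_insert_iff, Set.mem_singleton_iff]
  grind

lemma mu_one_six_eq : mu 1 6 = {E | |E| ∈ Set.Ioo 0 1 \ {1 / 2, √3 / 2}} := by
  refine isProfile₆.mu_eq (n := 0) bands_one_six excluded_one_six ?_
  rintro E ⟨h0, h1⟩
  simp only [Set.mem_union, Set.mem_sdiff, Set.mem_Ioo, Set.mem_insert_iff, Set.mem_singleton_iff]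
  grind

lemma mu_two_four_eq : mu 2 4 = {E | |E| ∈ Set.Ioo 0 (1 / 2) ∪ Set.Ioo (1 / √2) 1} := by
  refine isProfile₄.mu_eq (n := 1) bands_two_four excluded_two_four ?_
  rintro E ⟨h0, h1⟩
  simp only [Set.mem_union, Set.mem_Ioo, Set.mem_Icc, Set.mem_insert_iff, Set.mem_singleton_iff]
  grind

end Bands

end MolchanovVainberg

end

/-! ### Assembly of the theorem -/

theorem mainTheorem6 :
    -- symmetry about zero
    (∀ d ∈ ({1, 2, 3} : Set ℕ), ∀ κ ∈ ({2, 4, 6} : Set ℕ), ∀ E : ℝ,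
      E ∈ MolchanovVainberg.mu d κ ↔ -E ∈ MolchanovVainberg.mu d κ) ∧
    -- bands, `κ = 2`
    (∀ d ∈ ({1, 2, 3} : Set ℕ),
      Set.Ioo 0 1 ⊆ MolchanovVainberg.mu d 2 ∩ Set.Icc 0 1) ∧
    -- bands, `κ = 4`
    Set.Ioo 0 1 \ {1 / √2} ⊆ MolchanovVainberg.mu 1 4 ∩ Set.Icc 0 1 ∧
    Set.Ioo 0 (1 / 2) ∪ Set.Ioo (1 / √2) 1 ⊆ MolchanovVainberg.mu 2 4 ∩ Set.Icc 0 1 ∧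
    Set.Ioo 0 (√(3 - √3) / 4) ∪ Set.Ioo (1 / √2) 1 ⊆
      MolchanovVainberg.mu 3 4 ∩ Set.Icc 0 1 ∧
    -- bands, `κ = 6`
    Set.Ioo 0 1 \ {1 / 2, √3 / 2} ⊆ MolchanovVainberg.mu 1 6 ∩ Set.Icc 0 1 ∧
    Set.Ioo 0 0.21 ∪ Set.Ioo 0.53 0.71 ∪ Set.Ioo (√3 / 2) 1 ⊆
      MolchanovVainberg.mu 2 6 ∩ Set.Icc 0 1 ∧
    Set.Ioo 0 0.08 ∪ Set.Ioo 0.57 0.58 ∪ Set.Ioo (√3 / 2) 1 ⊆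
      MolchanovVainberg.mu 3 6 ∩ Set.Icc 0 1 ∧
    -- excluded sets, `κ = 2`
    (∀ d ∈ ({1, 2, 3} : Set ℕ),
      {0, 1} ⊆ Set.Icc 0 1 \ MolchanovVainberg.mu d 2) ∧
    -- excluded sets, `κ = 4`
    {0, 1 / √2, 1} ⊆ Set.Icc 0 1 \ MolchanovVainberg.mu 1 4 ∧
    Set.Icc (1 / 2) (1 / √2) ∪ {0, 1} ⊆ Set.Icc 0 1 \ MolchanovVainberg.mu 2 4 ∧
    Set.Icc (1 / (2 * √2)) (1 / √2) ∪ {0, 1} ⊆ Set.Icc 0 1 \ MolchanovVainberg.mu 3 4 ∧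
    -- excluded sets, `κ = 6`
    {0, 1 / 2, √3 / 2, 1} ⊆ Set.Icc 0 1 \ MolchanovVainberg.mu 1 6 ∧
    Set.Icc (1 / 4) (1 / 2) ∪ Set.Icc (3 / 4) (√3 / 2) ∪ {0, 1} ⊆
      Set.Icc 0 1 \ MolchanovVainberg.mu 2 6 ∧
    Set.Icc (1 / 8) (1 / 2) ∪ Set.Icc (3 * √3 / 8) (√3 / 2) ∪ {0, 1} ⊆
      Set.Icc 0 1 \ MolchanovVainberg.mu 3 6 ∧
    -- the cases in which the whole set is determined
    (∀ d ∈ ({1, 2, 3} : Set ℕ),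
      MolchanovVainberg.mu d 2 = Set.Ioo (-1) 0 ∪ Set.Ioo 0 1) ∧
    MolchanovVainberg.mu 1 4 = {E | |E| ∈ Set.Ioo 0 1 \ {1 / √2}} ∧
    MolchanovVainberg.mu 1 6 = {E | |E| ∈ Set.Ioo 0 1 \ {1 / 2, √3 / 2}} ∧
    MolchanovVainberg.mu 2 4 = {E | |E| ∈ Set.Ioo 0 (1 / 2) ∪ Set.Ioo (1 / √2) 1} := by
  have hd : ∀ d ∈ ({1, 2, 3} : Set ℕ), ∃ n, d = n + 1 := by
    rintro d (rfl | rfl | rfl)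
    exacts [⟨0, rfl⟩, ⟨1, rfl⟩, ⟨2, rfl⟩]
  open MolchanovVainberg in
  refine ⟨?_, ?_, bands_one_four, bands_two_four, bands_three_four, bands_one_six, bands_two_six,
    bands_three_six, ?_, excluded_one_four, excluded_two_four, excluded_three_four,
    excluded_one_six, excluded_two_six, excluded_three_six, ?_, mu_one_four_eq, mu_one_six_eq,
    mu_two_four_eq⟩
  · intro d hd' κ hκ E
    obtain ⟨n, rfl⟩ := hd d hd'
    rcases hκ with rfl | rfl | rfl
    · exact MolchanovVainberg.isProfile₂.neg_mem_mu_iff.symm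
    · exact MolchanovVainberg.isProfile₄.neg_mem_mu_iff.symm
    · exact MolchanovVainberg.isProfile₆.neg_mem_mu_iff.symm
  · intro d hd'
    obtain ⟨n, rfl⟩ := hd d hd'
    exact MolchanovVainberg.Ioo_subset_mu_two
  · intro d hd'
    obtain ⟨n, rfl⟩ := hd d hd'
    exact MolchanovVainberg.isProfile₂.pair_subset_diff_mu
      MolchanovVainberg.continuous_profile₂ MolchanovVainberg.profile₂_one
  · intro d hd'
    obtain ⟨n, rfl⟩ := hd d hd'
    exact MolchanovVainberg.mu_two_eq
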